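/- Let $\mathbb{H}=\{z\in\mathbb{C}:\operatorname{Re} z>0\}$. Let $V\subset\mathbb{C}$ be an unbounded Jordan domain, i.e. an unbounded domain in $\mathbb{C}$ whose boundary in the Riemann sphere $\hat{\mathbb{C}}=\mathbb{C}\cup\{\infty\}$ is a Jordan curve (necessarily through $\infty$). Let $\Psi:V\to\mathbb{H}$ be a conformal isomorphism with $\Psi(\infty)=\infty$, i.e. $\Psi(z)\to\infty$ as $z\to\infty$ in $V$. Let $1<\rho<2$ and define $$f:V\to\mathbb{C},\qquad f(z)=\exp\bigl(\Psi(z)^{\rho}\bigr),$$ where the power is the principal branch on $\mathbb{H}$. For an entire function $g$, call $a\in\mathbb{C}$ a singular value of $g$ if for every open neighbourhood $U$ of $a$ there is a connected component $C$ of $g^{-1}(U)$ such that $g:C\to U$ is not bijective; let $\mathcal{B}$ denote the class of all transcendental (that is, non-polynomial) entire functions whose set of singular values in $\mathbb{C}$ is bounded. Then there exist $g\in\mathcal{B}$ and a number $K>0$ such that the following hold. 1. $W:=\{z\in\mathbb{C}:|g(z)|>K\}$ is a simply connected domain contained in $V$, and $g|_W:W\to\{w\in\mathbb{C}:|w|>K\}$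 is a universal covering (in particular surjective). 2. $|g(z)-f(z)|$ is bounded on $W$, and $|g(z)|$ is bounded on $\mathbb{C}\setminus W$. -/

import Mathlib

open Set Filter Topology

namespace PrescribedTracts

/-- The open right half plane. -/
def rightHalfPlane : Set ℂ := {z | 0 < z.re}

/-- An unbounded Jordan domain `V ⊆ ℂ`: an unbounded domain whose boundary, taken in the Riemann
sphere `OnePoint ℂ`, is a Jordan curve, that is, the image of the circle under a continuous
injective map. (As `V` is unbounded and lies in `ℂ`, this curve passes through `∞`.) -/
structure IsUnboundedJordanDomain (V : Set ℂ) : Prop where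
  isOpen : IsOpen V
  isConnected : IsConnected V
  not_isBounded : ¬ Bornology.IsBounded V
  exists_jordan_curve : ∃ γ : Circle → OnePoint ℂ, Continuous γ ∧ Function.Injective γ ∧
    frontier ((fun z : ℂ => (z : OnePoint ℂ)) '' V) = range γ

/-- `Ψ` is a conformal isomorphism from `V` onto `U`. -/
def IsConformalIso (Ψ : ℂ → ℂ) (V U : Set ℂ) : Prop :=
  DifferentiableOn ℂ Ψ V ∧ BijOn Ψ V U

/-- `Ψ(∞) = ∞` for the boundary extension of a map `Ψ` defined on `V`: the value of the
extension at the boundary point `∞` is the limit of `Ψ z` as `z → ∞` in `V`. -/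
def FixesInfinity (Ψ : ℂ → ℂ) (V : Set ℂ) : Prop :=
  Tendsto Ψ (Bornology.cobounded ℂ ⊓ 𝓟 V) (Bornology.cobounded ℂ)

/-- The finite singular values of an entire function `g`: those `a` such that for every open
neighbourhood `U` of `a` some connected component of `g ⁻¹' U` is not mapped bijectively
onto `U` by `g`. -/
def singularValues (g : ℂ → ℂ) : Set ℂ :=
  {a | ∀ U : Set ℂ, IsOpen U → a ∈ U →
    ∃ z ∈ g ⁻¹' U, ¬ BijOn g (connectedComponentIn (g ⁻¹' U) z) U}

/-- The Eremenko-Lyubich class: transcendental (i.e. non-polynomial) entire functions whose set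
of finite singular values is bounded. -/
structure EremenkoLyubich (g : ℂ → ℂ) : Prop where
  entire : Differentiable ℂ g
  transcendental : ¬ ∃ p : Polynomial ℂ, ∀ z, g z = p.eval z
  isBounded_singularValues : Bornology.IsBounded (singularValues g)

/-- A universal covering: a surjective covering map with simply connected total space. -/
structure IsUniversalCovering {E X : Type*} [TopologicalSpace E] [TopologicalSpace X]
    (p : E → X) : Prop where
  isCoveringMap : IsCoveringMap p
  surjective : Function.Surjective p
  simplyConnectedSpace : SimplyConnectedSpace E

end PrescribedTracts

/-! Work in the logarithmic coordinate s = log Ψ(z), which carries V onto the strip |Im s| < π/2,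
and let Φ be the inverse map. Then f becomes F(s) = exp(exp(ρs)), with |F(s)| = exp(e^{ρ Re s} cos(ρ
Im s)). Because 1 < ρ < 2, the cosine is negative near both edges of the strip, so F decays doubly
exponentially there, while it is huge in the middle.

The entire function is built from Cauchy integrals. Off the image of a half strip, g is -(1/2πi) ∫
F(s)Φ'(s)/(Φ(s) - z) ds over the boundary of that half strip. Inside, it is F∘Φ⁻¹ minus the
analogous integral, divided by 2πi, over a larger half strip. The residue theorem makes the two
formulas agree on a collar. If Φ omits z on the δ-disc about s, a Koebe-type estimate
(`norm_deriv_le_of_injOn_ball`) gives |Φ'(s)/(Φ(s) - z)| ≤ 500/δ, whatever the shape of V. So the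
integrals converge with bounds independent of z: g - f is bounded on V and g is bounded off V
(`exists_entire_approx`).

The construction needs images of closed, narrower half strips to be closed, which follows once Φ(s)
→ ∞ as Re s → ∞ there. Since V is a Jordan domain it is locally connected at ∞, by a separation
argument of Janiszewski type (`exists_isPreconnected_near_infty`). Hence every far vertical segment
contains a point with large image, and a length-area argument together with the Koebe estimate
spreads this over narrower strips (`exists_forall_lt_norm_of_strip`).

Finally, in the coordinate τ = e^{ρs}, log g is τ + η(τ) with η small and contracting on a far half
plane, hence invertible (`exists_isExpTract`). On {|g| > K} the function g is therefore exp composed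
with a homeomorphism onto a half plane. The covering property, simple connectivity, boundedness of
the singular values and transcendence all follow from this (`IsExpTract`). -/

namespace PrescribedTracts

/-! ### Distortion estimates of Bloch and Koebe type -/

open Metric in
/-- A weak form of Bloch's theorem. -/
theorem exists_ball_subset_image_of_deriv {f : ℂ → ℂ} {c : ℂ} {r R : ℝ} (hr : 0 < r) (hrR : r < R)
    (hf : DifferentiableOn ℂ f (ball c R)) :
    ∃ w, ball w (r * ‖deriv f c‖ / 64) ⊆ f '' ball c R := by
  rcases (norm_nonneg (deriv f c)).eq_or_lt' with h0 | h0
  · exact ⟨0, by simp [h0]⟩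
  have hsub : closedBall c r ⊆ ball c R := closedBall_subset_ball hrR
  have hf' : DifferentiableOn ℂ (deriv f) (ball c R) := hf.deriv isOpen_ball
  -- Landau's trick: at a maximum z₀ of the weight (r - |z - c|)|f'(z)|, the derivative at most
  -- doubles on the disc of radius s/2 about z₀, while sM is still at least r|f'(c)|.
  have hcont : ContinuousOn (fun z => (r - dist z c) * ‖deriv f z‖) (closedBall c r) :=
    ContinuousOn.mul (by fun_prop) (hf'.continuousOn.mono hsub).norm
  obtain ⟨z₀, hz₀, hmax⟩ := (isCompact_closedBall c r).exists_isMaxOn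
    ⟨c, mem_closedBall_self hr.le⟩ hcont
  have hmax' : ∀ z, dist z c ≤ r → (r - dist z c) * ‖deriv f z‖ ≤
      (r - dist z₀ c) * ‖deriv f z₀‖ := fun z hz => hmax hz
  set M := ‖deriv f z₀‖ with hM
  set s := r - dist z₀ c with hs
  have hsM : r * ‖deriv f c‖ ≤ s * M := by simpa using hmax' c (by simpa using hr.le)
  have hsMpos : 0 < s * M := (by positivity : 0 < r * ‖deriv f c‖).trans_le hsM
  have hspos : 0 < s := by
    have : 0 ≤ s := by rw [hs, sub_nonneg]; exact hz₀
    rcases this.eq_or_lt' with h | h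
    · simp [h] at hsMpos
    · exact h
  have hMpos : 0 < M := by
    rcases (norm_nonneg (deriv f z₀)).eq_or_lt' with h | h
    · simp [hM, h] at hsMpos
    · exact h
  have hball : ∀ z ∈ ball z₀ (s / 2), dist z c < r - s / 2 := by
    intro z hz
    have h1 := dist_triangle z z₀ c
    have h2 := mem_ball.1 hz
    rw [hs] at h2 ⊢
    linarith
  have hballR : ball z₀ (s / 2) ⊆ ball c R := fun z hz => by
    have := hball z hz
    rw [mem_ball]; linarith
  have h2M : ∀ z ∈ ball z₀ (s / 2), ‖deriv f z‖ ≤ 2 * M := by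
    intro z hz
    have h1 := hball z hz
    have h2 := hmax' z (by linarith)
    have h3 : s / 2 * ‖deriv f z‖ ≤ (r - dist z c) * ‖deriv f z‖ := by gcongr; linarith
    have h4 : s * ‖deriv f z‖ ≤ s * (2 * M) := by linarith
    exact le_of_mul_le_mul_left h4 hspos
  have hlin : ∀ z ∈ ball z₀ (s / 2), ‖deriv f z - deriv f z₀‖ ≤ 3 * M / (s / 2) * dist z z₀ := by
    intro z hz
    rw [← dist_eq_norm]
    refine Complex.dist_le_div_mul_dist_of_mapsTo_ball (hf'.mono hballR) ?_ hz
    intro y hy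
    rw [mem_closedBall, dist_eq_norm]
    linarith [norm_sub_le (deriv f y) (deriv f z₀), h2M y hy]
  -- Within distance s/16 of z₀ the derivative deviates from f'(z₀) by at most 3M/8 ≤ M/2. So f
  -- moves points of the sphere by at least Mt/2, and the open mapping estimate covers a disc of
  -- radius Mt/4 = sM/64.
  set t := s / 16 with ht
  have htpos : 0 < t := by positivity
  have htb : closedBall z₀ t ⊆ ball z₀ (s / 2) := closedBall_subset_ball (by linarith)
  have hd : ∀ z ∈ closedBall z₀ t, HasDerivAt f (deriv f z) z := fun z hz =>
    (hf.differentiableAt (isOpen_ball.mem_nhds (hballR (htb hz)))).hasDerivAt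
  have hlow : ∀ z ∈ sphere z₀ t, M * t / 2 ≤ ‖f z - f z₀‖ := by
    intro z hz
    have h1 : ‖(f z - deriv f z₀ * z) - (f z₀ - deriv f z₀ * z₀)‖ ≤ M / 2 * ‖z - z₀‖ := by
      refine Convex.norm_image_sub_le_of_norm_hasDerivWithin_le (s := closedBall z₀ t)
        (f := fun z => f z - deriv f z₀ * z) (f' := fun z => deriv f z - deriv f z₀) (𝕜 := ℂ)
        (fun y hy => ?_) (fun y hy => ?_) (convex_closedBall _ _)
        (mem_closedBall_self htpos.le) (sphere_subset_closedBall hz)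
      · simpa using ((hd y hy).fun_sub ((hasDerivAt_id y).const_mul (deriv f z₀))).hasDerivWithinAt
      · refine (hlin y (htb hy)).trans ?_
        have : dist y z₀ ≤ s / 16 := hy
        calc 3 * M / (s / 2) * dist y z₀ ≤ 3 * M / (s / 2) * (s / 16) := by gcongr
          _ ≤ M / 2 := by field_simp; norm_num
    have hzn : ‖z - z₀‖ = t := by simpa [dist_eq_norm] using hz
    have h2 : deriv f z₀ * (z - z₀) = (f z - f z₀) -
      ((f z - deriv f z₀ * z) - (f z₀ - deriv f z₀ * z₀)) := by ring
    have h3 : M * t ≤ ‖f z - f z₀‖ + M / 2 * t := by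
      calc M * t = ‖deriv f z₀ * (z - z₀)‖ := by rw [norm_mul, hzn]
        _ ≤ _ := by rw [h2]; exact (norm_sub_le _ _).trans (by rw [← hzn]; gcongr)
    linarith
  refine ⟨f z₀, ?_⟩
  have hnc : ∃ᶠ z in 𝓝 z₀, f z ≠ f z₀ := by
    intro h
    have h' : f =ᶠ[𝓝 z₀] fun _ => f z₀ := by
      filter_upwards [h] with z hz using not_not.1 hz
    have := h'.deriv_eq
    simp only [deriv_const'] at this
    simp [hM, this] at hMpos
  have key := DiffContOnCl.ball_subset_image_closedBall (z₀ := z₀) (r := t) (f := f)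
    (ε := M * t / 2) ?_ htpos hlow hnc
  · refine (ball_subset_ball ?_).trans (key.trans (image_mono (htb.trans hballR)))
    rw [ht]; linarith
  · exact (hf.mono (htb.trans hballR)).diffContOnCl_ball subset_rfl

open Metric in
/-- A weak form of the Koebe quarter theorem. -/
theorem norm_deriv_le_of_injOn_ball {f : ℂ → ℂ} {c w : ℂ} {δ : ℝ} (hδ : 0 < δ)
    (hf : DifferentiableOn ℂ f (ball c δ)) (hinj : InjOn f (ball c δ))
    (hw : ∀ z ∈ ball c δ, f z ≠ w) : ‖deriv f c‖ ≤ 500 / δ * ‖f c - w‖ := by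
  have hne : ∀ z ∈ ball c δ, f z - w ≠ 0 := fun z hz => sub_ne_zero.2 (hw z hz)
  have hc : c ∈ ball c δ := mem_ball_self hδ
  have hd : DifferentiableOn ℂ (fun z => deriv f z / (f z - w)) (ball c δ) :=
    (hf.deriv isOpen_ball).div (hf.sub_const w) hne
  obtain ⟨l, hl⟩ := hd.isExactOn_ball
  have hfd : ∀ z ∈ ball c δ, HasDerivAt f (deriv f z) z := fun z hz =>
    (hf.differentiableAt (isOpen_ball.mem_nhds hz)).hasDerivAt
  have hprod : ∀ z ∈ ball c δ, HasDerivAt (fun z => (f z - w) * Complex.exp (-l z)) 0 z := by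
    intro z hz
    have := hne z hz
    refine (((hfd z hz).sub_const w).fun_mul (hl z hz).fun_neg.cexp).congr_deriv ?_
    simp only
    field_simp
    ring
  have hconst : ∀ z ∈ ball c δ, (f z - w) * Complex.exp (-l z) =
      (f c - w) * Complex.exp (-l c) := by
    intro z hz
    exact (convex_ball c δ).is_const_of_fderivWithin_eq_zero (𝕜 := ℂ)
      (fun y hy => (hprod y hy).differentiableAt.differentiableWithinAt)
      (fun y hy => by
        rw [fderivWithin_of_isOpen isOpen_ball hy]
        ext; simp [(hprod y hy).deriv]) hz hc
  -- Up to a constant, `l` is a branch of log(f - w), so injectivity of f forbids two values of `l`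
  -- differing by 2πi. Its image then contains no disc of radius greater than π, and Bloch's theorem
  -- bounds l'(c) = f'(c)/(f(c) - w). The constant comes from 128π < 500.
  have hper : ∀ x ∈ ball c δ, ∀ y ∈ ball c δ, l x ≠ l y → Complex.exp (l x) ≠ Complex.exp (l y) := by
    intro x hx y hy hxy he
    have h1 := (hconst x hx).trans (hconst y hy).symm
    rw [Complex.exp_neg, Complex.exp_neg, he] at h1
    have h2 := mul_right_cancel₀ (inv_ne_zero (Complex.exp_ne_zero _)) h1
    exact hxy (congrArg l (hinj hx hy (sub_left_inj.1 h2)))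
  have hlc : deriv l c = deriv f c / (f c - w) := (hl c hc).deriv
  obtain ⟨p, hp⟩ := exists_ball_subset_image_of_deriv (half_pos hδ) (half_lt_self hδ)
    (fun z hz => (hl z hz).differentiableAt.differentiableWithinAt)
  have hle : δ / 2 * ‖deriv l c‖ / 64 ≤ Real.pi := by
    by_contra! hlt
    have hI : ‖(Real.pi : ℂ) * Complex.I‖ = Real.pi := by simp [abs_of_pos Real.pi_pos]
    obtain ⟨x, hx, hxe⟩ := hp (show p + Real.pi * Complex.I ∈ _ by
      rw [mem_ball, dist_eq_norm, add_sub_cancel_left, hI]; exact hlt)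
    obtain ⟨y, hy, hye⟩ := hp (show p - Real.pi * Complex.I ∈ _ by
      rw [mem_ball, dist_eq_norm, sub_sub_cancel_left, norm_neg, hI]; exact hlt)
    refine hper x hx y hy ?_ ?_
    · rw [hxe, hye]
      intro h
      have h2 : (2 : ℂ) * (Real.pi * Complex.I) = 0 := by linear_combination h
      simp [Real.pi_ne_zero] at h2
    · rw [hxe, hye, Complex.exp_eq_exp_iff_exists_int]
      exact ⟨1, by push_cast; ring⟩
  have hpos : 0 < ‖f c - w‖ := norm_pos_iff.2 (hne c hc)
  rw [hlc, norm_div] at hle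
  have h3 : ‖deriv f c‖ / ‖f c - w‖ ≤ 500 / δ := by
    rw [le_div_iff₀ hδ]
    have := Real.pi_lt_d2
    linarith
  rwa [div_le_iff₀ hpos] at h3

/-! ### Inverses of injective holomorphic maps -/

/-- The image of an open set under an injective holomorphic map is open, and the inverse is
holomorphic. -/
theorem differentiableOn_of_leftInvOn {Ψ Φ : ℂ → ℂ} {V : Set ℂ} (hV : IsOpen V)
    (hΨ : DifferentiableOn ℂ Ψ V) (hinj : InjOn Ψ V) (hΦ : LeftInvOn Φ Ψ V) :
    (∀ U ⊆ V, IsOpen U → IsOpen (Ψ '' U)) ∧ DifferentiableOn ℂ Φ (Ψ '' V) := by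
  have han : AnalyticOnNhd ℂ Ψ V := hΨ.analyticOnNhd hV
  have hnc : ∀ z ∈ V, ¬ ∀ᶠ y in 𝓝 z, Ψ y = Ψ z := by
    intro z hz h
    have h1 : ∀ᶠ y in 𝓝 z, y = z := by
      filter_upwards [h, hV.mem_nhds hz] with y hy hyV using hinj hyV hz hy
    have h2 : ∀ᶠ y in 𝓝[≠] z, y = z := h1.filter_mono nhdsWithin_le_nhds
    have h3 : ∀ᶠ y in 𝓝[≠] z, y ≠ z := eventually_mem_nhdsWithin
    obtain ⟨y, hy1, hy2⟩ := (h2.and h3).exists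
    exact hy2 hy1
  have hmap : ∀ z ∈ V, 𝓝 (Ψ z) ≤ map Ψ (𝓝 z) := fun z hz =>
    (han z hz).eventually_constant_or_nhds_le_map_nhds.resolve_left (hnc z hz)
  have hopen : ∀ U ⊆ V, IsOpen U → IsOpen (Ψ '' U) := by
    intro U hUV hU
    rw [isOpen_iff_mem_nhds]
    rintro _ ⟨z, hz, rfl⟩
    exact hmap z (hUV hz) (image_mem_map (hU.mem_nhds hz))
  have hcont : ∀ z ∈ V, ContinuousAt Φ (Ψ z) := by
    intro z hz
    rw [ContinuousAt, hΦ hz]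
    refine (map_mono (hmap z hz)).trans ?_
    rw [map_map]
    have : Tendsto id (𝓝 z) (𝓝 z) := tendsto_id
    refine this.congr' ?_
    filter_upwards [hV.mem_nhds hz] with y hy using (hΦ hy).symm
  -- The inverse function theorem applies away from critical points. These are isolated, and
  -- continuity of Φ makes their images removable singularities, so Ψ' ≠ 0 need not be known
  -- beforehand.
  have hgood : ∀ z ∈ V, deriv Ψ z ≠ 0 → DifferentiableAt ℂ Φ (Ψ z) := by
    intro z hz hz'
    have h1 : HasDerivAt Ψ (deriv Ψ z) (Φ (Ψ z)) := by
      rw [hΦ hz]; exact (han z hz).differentiableAt.hasDerivAt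
    refine (HasDerivAt.of_local_left_inverse (hcont z hz) h1 hz' ?_).differentiableAt
    filter_upwards [(hopen V subset_rfl hV).mem_nhds (mem_image_of_mem Ψ hz)]
    rintro _ ⟨y, hy, rfl⟩
    rw [hΦ hy]
  refine ⟨hopen, ?_⟩
  rintro _ ⟨z, hz, rfl⟩
  apply DifferentiableAt.differentiableWithinAt
  refine AnalyticAt.differentiableAt
    (Complex.analyticAt_of_differentiable_on_punctured_nhds_of_continuousAt ?_ (hcont z hz))
  have hz' : ∀ᶠ y in 𝓝[≠] z, deriv Ψ y ≠ 0 := by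
    refine (han z hz).deriv.eventually_eq_zero_or_eventually_ne_zero.resolve_left fun h => ?_
    refine hnc z hz ?_
    obtain ⟨r, hr, hrs⟩ := Metric.eventually_nhds_iff_ball.1
      (h.and (hV.mem_nhds hz))
    filter_upwards [Metric.ball_mem_nhds z hr] with y hy
    exact (convex_ball z r).is_const_of_fderivWithin_eq_zero (𝕜 := ℂ)
      (fun x hx => (han x (hrs x hx).2).differentiableAt.differentiableWithinAt)
      (fun x hx => by
        rw [fderivWithin_of_isOpen Metric.isOpen_ball hx]
        ext; simp [(hrs x hx).1]) hy (Metric.mem_ball_self hr)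
  rw [eventually_nhdsWithin_iff] at hz' ⊢
  refine (hmap z hz) ?_
  rw [mem_map]
  filter_upwards [hz', hV.mem_nhds hz] with y hy hyV hne
  exact hgood y hyV (hy fun h => hne (by rw [mem_singleton_iff.1 h]; rfl))

/-! ### Continuous logarithms and separation in the sphere -/

/-- The Möbius transformation `w ↦ 1 / (w - b)` on the sphere, with value `0` at `∞`. -/
noncomputable def recip (b : ℂ) (w : OnePoint ℂ) : ℂ := w.elim 0 fun w => (w - b)⁻¹

@[simp] theorem recip_coe (b w : ℂ) : recip b (w : OnePoint ℂ) = (w - b)⁻¹ := rfl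

@[simp] theorem recip_infty (b : ℂ) : recip b OnePoint.infty = 0 := rfl

theorem continuousOn_recip {b : ℂ} {K : Set (OnePoint ℂ)} (hb : (b : OnePoint ℂ) ∉ K) :
    ContinuousOn (recip b) K := by
  intro w hw
  apply ContinuousAt.continuousWithinAt
  induction w with
  | infty =>
    rw [OnePoint.continuousAt_infty', coclosedCompact_eq_cocompact, recip_infty,
      ← Metric.cobounded_eq_cocompact]
    have h : Tendsto (fun w : ℂ => w - b) (Bornology.cobounded ℂ) (Bornology.cobounded ℂ) := by
      simp [sub_eq_add_neg, tendsto_add_const_cobounded (-b)]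
    exact (tendsto_inv₀_cobounded).comp h
  | coe w =>
    rw [OnePoint.continuousAt_coe]
    have : w - b ≠ 0 := sub_ne_zero.2 (by rintro rfl; exact hb hw)
    exact ContinuousAt.inv₀ (by fun_prop) this

/-- There is a continuous branch of `log ((w - z) / (w - b))` on the set `K`. -/
def HasLogOn (K : Set (OnePoint ℂ)) (z b : ℂ) : Prop :=
  ∃ L : OnePoint ℂ → ℂ, ContinuousOn L K ∧ ∀ w ∈ K, Complex.exp (L w) = 1 + (b - z) * recip b w

theorem HasLogOn.symm {K : Set (OnePoint ℂ)} {z b : ℂ} (hz : (z : OnePoint ℂ) ∉ K)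
    (hb : (b : OnePoint ℂ) ∉ K) (h : HasLogOn K z b) : HasLogOn K b z := by
  obtain ⟨L, hL, hexp⟩ := h
  refine ⟨fun w => -L w, hL.neg, fun w hw => ?_⟩
  rw [Complex.exp_neg, hexp w hw]
  induction w with
  | infty => simp
  | coe w =>
    have h1 : w - z ≠ 0 := sub_ne_zero.2 (by rintro rfl; exact hz hw)
    have h2 : w - b ≠ 0 := sub_ne_zero.2 (by rintro rfl; exact hb hw)
    have h3 : 1 + (b - z) * recip b (w : OnePoint ℂ) = (w - z) / (w - b) := by
      simp only [recip_coe]; field_simp; ring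
    rw [h3, inv_div]
    simp only [recip_coe]; field_simp; ring

theorem HasLogOn.trans {K : Set (OnePoint ℂ)} {z b c : ℂ}
    (hb : (b : OnePoint ℂ) ∉ K) (hc : (c : OnePoint ℂ) ∉ K)
    (h₁ : HasLogOn K z b) (h₂ : HasLogOn K b c) : HasLogOn K z c := by
  obtain ⟨L₁, hL₁, hexp₁⟩ := h₁
  obtain ⟨L₂, hL₂, hexp₂⟩ := h₂
  refine ⟨fun w => L₁ w + L₂ w, hL₁.add hL₂, fun w hw => ?_⟩
  rw [Complex.exp_add, hexp₁ w hw, hexp₂ w hw]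
  induction w with
  | infty => simp
  | coe w =>
    have h1 : w - c ≠ 0 := sub_ne_zero.2 (by rintro rfl; exact hc hw)
    have h2 : w - b ≠ 0 := sub_ne_zero.2 (by rintro rfl; exact hb hw)
    simp only [recip_coe]; field_simp; ring

/-- Having a logarithm is an equivalence relation between points off K, and its classes are open:
for y near x the function 1 + (x - y)/(w - x) stays in the slit plane for w ∈ K. A preconnected set
off K therefore meets only one class. -/
theorem hasLogOn_of_isPreconnected {K : Set (OnePoint ℂ)} (hK : IsClosed K) {E : Set ℂ}
    (hE : IsPreconnected E) (hEK : ∀ e ∈ E, (e : OnePoint ℂ) ∉ K) {z b : ℂ} (hz : z ∈ E)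
    (hb : b ∈ E) : HasLogOn K z b := by
  refine hE.induction₂ (HasLogOn K) ?_ ?_ ?_ hz hb
  · intro x hx
    have hopen : IsOpen ((fun e : ℂ => (e : OnePoint ℂ)) ⁻¹' Kᶜ) :=
      hK.isOpen_compl.preimage OnePoint.continuous_coe
    obtain ⟨r, hr, hball⟩ := Metric.isOpen_iff.1 hopen x (hEK x hx)
    filter_upwards [mem_nhdsWithin_of_mem_nhds (Metric.ball_mem_nhds x hr),
      self_mem_nhdsWithin] with y hy hyE
    refine HasLogOn.symm (hEK y hyE) (hEK x hx) ?_
    have hsmall : ∀ w ∈ K, ‖(x - y) * recip x w‖ < 1 := by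
      intro w hw
      induction w with
      | infty => simp
      | coe w =>
        have h1 : r ≤ ‖w - x‖ := by
          by_contra! h
          exact hball (show w ∈ Metric.ball x r by simpa [dist_eq_norm] using h) hw
        have h2 : ‖x - y‖ < r := by simpa [dist_eq_norm, norm_sub_rev] using hy
        rw [recip_coe, norm_mul, norm_inv, ← div_eq_mul_inv, div_lt_one (hr.trans_le h1)]
        exact h2.trans_le h1
    have hslit : ∀ w ∈ K, 1 + (x - y) * recip x w ∈ Complex.slitPlane := fun w hw =>
      Complex.mem_slitPlane_of_norm_lt_one (hsmall w hw)
    refine ⟨fun w => Complex.log (1 + (x - y) * recip x w), ?_, fun w hw => ?_⟩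
    · exact ContinuousOn.clog (continuousOn_const.add
        (continuousOn_const.mul (continuousOn_recip (hEK x hx)))) hslit
    · exact Complex.exp_log (Complex.slitPlane_ne_zero (hslit w hw))
  · intro x y c hx hy hc h₁ h₂
    exact h₁.trans (hEK y hy) (hEK c hc) h₂
  · intro x y hx hy h
    exact h.symm (hEK x hx) (hEK y hy)

/-- Two continuous logarithms of the same function on a preconnected set differ by a constant. -/
theorem exists_eq_add_int_of_exp_eq {X : Type*} [TopologicalSpace X] {A : Set X}
    (hA : IsPreconnected A) {L₁ L₂ : X → ℂ} (h₁ : ContinuousOn L₁ A) (h₂ : ContinuousOn L₂ A)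
    (hexp : ∀ w ∈ A, Complex.exp (L₁ w) = Complex.exp (L₂ w)) :
    ∃ n : ℤ, ∀ w ∈ A, L₁ w = L₂ w + n * (2 * Real.pi * Complex.I) := by
  rcases A.eq_empty_or_nonempty with rfl | ⟨a, ha⟩
  · exact ⟨0, by simp⟩
  have hex : ∀ w ∈ A, ∃ n : ℤ, L₁ w = L₂ w + n * (2 * Real.pi * Complex.I) := fun w hw =>
    Complex.exp_eq_exp_iff_exists_int.1 (hexp w hw)
  obtain ⟨n, hn⟩ := hex a ha
  refine ⟨n, fun w hw => ?_⟩
  obtain ⟨m, hm⟩ := hex w hw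
  set φ : X → ℝ := fun w => ((L₁ w - L₂ w) / (2 * Real.pi * Complex.I)).re with hφ
  have hval : ∀ w (k : ℤ), L₁ w = L₂ w + k * (2 * Real.pi * Complex.I) → φ w = k := by
    intro w k h
    have : (2 * Real.pi * Complex.I : ℂ) ≠ 0 := Complex.two_pi_I_ne_zero
    simp only [hφ, h, add_sub_cancel_left, mul_div_cancel_right₀ _ this]
    simp
  have hcont : ContinuousOn φ A :=
    Complex.continuous_re.comp_continuousOn ((h₁.sub h₂).div_const _)
  have himg : φ '' A ⊆ range ((↑) : ℤ → ℝ) := by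
    rintro _ ⟨w, hw, rfl⟩
    obtain ⟨k, hk⟩ := hex w hw
    exact ⟨k, (hval w k hk).symm⟩
  have hsub : (φ '' A).Subsingleton :=
    ((Set.countable_range _).mono himg).isTotallyDisconnected
      (φ '' A) subset_rfl (hA.image φ hcont)
  have : φ w = φ a := hsub (mem_image_of_mem _ hw) (mem_image_of_mem _ ha)
  rw [hval w m hm, hval a n hn] at this
  have hmn : m = n := by exact_mod_cast this
  rw [hm, hmn]

/-- The core of Janiszewski's theorem: on a preconnected overlap the two logarithms differ by a
constant multiple of 2πi, so one can be shifted and glued to the other. -/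
theorem HasLogOn.union {K₁ K₂ : Set (OnePoint ℂ)} (hK₁ : IsClosed K₁) (hK₂ : IsClosed K₂)
    (hpre : IsPreconnected (K₁ ∩ K₂)) {z b : ℂ} (h₁ : HasLogOn K₁ z b) (h₂ : HasLogOn K₂ z b) :
    HasLogOn (K₁ ∪ K₂) z b := by
  classical
  obtain ⟨L₁, hL₁, hexp₁⟩ := h₁
  obtain ⟨L₂, hL₂, hexp₂⟩ := h₂
  obtain ⟨n, hn⟩ := exists_eq_add_int_of_exp_eq hpre (hL₁.mono inter_subset_left)
    (hL₂.mono inter_subset_right) fun w hw => (hexp₁ w hw.1).trans (hexp₂ w hw.2).symm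
  set L : OnePoint ℂ → ℂ := fun w => if w ∈ K₁ then L₁ w else
    L₂ w + n * (2 * Real.pi * Complex.I) with hL
  have e₁ : EqOn L L₁ K₁ := fun w hw => by simp [hL, hw]
  have e₂ : EqOn L (fun w => L₂ w + n * (2 * Real.pi * Complex.I)) K₂ := fun w hw => by
    by_cases h : w ∈ K₁
    · simp [hL, h, hn w ⟨h, hw⟩]
    · simp [hL, h]
  refine ⟨L, ContinuousOn.union_of_isClosed (hL₁.congr e₁) ((hL₂.add continuousOn_const).congr e₂)
    hK₁ hK₂, ?_⟩
  rintro w (hw | hw)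
  · rw [e₁ hw, hexp₁ w hw]
  · rw [e₂ hw, Complex.exp_add, Complex.exp_int_mul_two_pi_mul_I, mul_one, hexp₂ w hw]

/-- **Borsuk**: a point at which the argument is well defined along a compact set lies in the
unbounded complementary component. -/
theorem not_isBounded_connectedComponentIn_of_log {K : Set ℂ} (hK : IsCompact K) {p : ℂ}
    (hp : p ∉ K) {L : ℂ → ℂ} (hL : ContinuousOn L K)
    (hexp : ∀ u ∈ K, Complex.exp (L u) = u - p) :
    ¬ Bornology.IsBounded (connectedComponentIn Kᶜ p) := by
  classical
  intro hbdd
  set U := connectedComponentIn Kᶜ p with hU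
  have hUo : IsOpen U := hK.isClosed.isOpen_compl.connectedComponentIn
  have hpU : p ∈ U := mem_connectedComponentIn hp
  have hUK : U ⊆ Kᶜ := connectedComponentIn_subset _ _
  have hfr : frontier U ⊆ K := by
    intro x hx
    by_contra hxK
    rw [hUo.frontier_eq] at hx
    refine hx.2 ?_
    have : IsPreconnected (insert x U) :=
      isPreconnected_connectedComponentIn.subset_closure (subset_insert _ _)
        (insert_subset hx.1 subset_closure)
    exact this.subset_connectedComponentIn (mem_insert_of_mem _ hpU)
      (insert_subset hxK hUK) (mem_insert _ _)
  -- Extend L by Tietze. If U were bounded, exp of the extension on U and u - p elsewhere would glue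
  -- to a zero-free function on the plane. That function has a global logarithm, yet on a circle
  -- about p outside U it equals u - p, whose logarithm gains 2πi.
  obtain ⟨M, hM⟩ := ContinuousMap.exists_restrict_eq hK.isClosed
    (⟨K.domRestrict L, hL.domRestrict⟩ : C(K, ℂ))
  have hML : ∀ u ∈ K, M u = L u := fun u hu => congrArg (fun f : C(K, ℂ) => f ⟨u, hu⟩) hM
  set G : ℂ → ℂ := fun u => if u ∈ U then Complex.exp (M u) else u - p with hG
  have hGc : Continuous G := by
    refine Continuous.if (fun u hu => ?_) (by fun_prop) (by fun_prop)
    have := hfr hu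
    rw [hML u this, hexp u this]
  have hG0 : ∀ u, G u ∈ ({0}ᶜ : Set ℂ) := by
    intro u
    by_cases h : u ∈ U
    · simp [hG, h]
    · have : u ≠ p := by rintro rfl; exact h hpU
      simpa [hG, h, sub_eq_zero] using this
  have he : Complex.exp (Complex.log (G 0)) = G 0 := Complex.exp_log (by simpa using hG0 0)
  obtain ⟨ℓ, ⟨-, hℓ⟩, -⟩ := Complex.isCoveringMapOn_exp.existsUnique_continuousMap_lifts
    (⟨G, hGc⟩ : C(ℂ, ℂ)) (a₀ := 0) he hG0
  have hℓ' : ∀ u, Complex.exp (ℓ u) = G u := fun u => congrFun hℓ u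
  obtain ⟨R, hR, hUR⟩ := hbdd.subset_ball_lt 0 p
  obtain ⟨n, hn⟩ := exists_eq_add_int_of_exp_eq (A := (univ : Set ℝ)) isPreconnected_univ
    (L₁ := fun θ : ℝ => ℓ (p + Complex.exp (Real.log R + θ * Complex.I)))
    (L₂ := fun θ : ℝ => Real.log R + θ * Complex.I)
    (by fun_prop) (by fun_prop) (by
      intro θ _
      rw [hℓ']
      have : p + Complex.exp (Real.log R + θ * Complex.I) ∉ U := by
        intro h
        have h2 := hUR h
        rw [Metric.mem_ball, dist_eq_norm, add_sub_cancel_left, Complex.norm_exp] at h2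
        simp [Real.exp_log hR] at h2
      simp only [hG, this, if_false, add_sub_cancel_left])
  have h0 := hn 0 trivial
  have h1 := hn (2 * Real.pi) trivial
  have hperiod : Complex.exp (Real.log R + (2 * Real.pi : ℝ) * Complex.I) =
      Complex.exp (Real.log R + (0 : ℝ) * Complex.I) := by
    push_cast
    rw [Complex.exp_add, Complex.exp_two_pi_mul_I]; simp
  rw [hperiod, h0] at h1
  have : (2 * Real.pi * Complex.I : ℂ) = 0 := by
    push_cast at h1
    linear_combination -h1
  exact Complex.two_pi_I_ne_zero this

/-- A logarithm of `(w - z) / (w - b)` on a closed subset of the sphere through `∞` shows that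
this set does not separate `z` from `b`. -/
theorem HasLogOn.exists_isPreconnected {K : Set (OnePoint ℂ)} (hK : IsClosed K) {z b : ℂ}
    (hz : (z : OnePoint ℂ) ∉ K) (hb : (b : OnePoint ℂ) ∉ K) (hinf : OnePoint.infty ∈ K)
    (h : HasLogOn K z b) :
    ∃ E : Set ℂ, IsPreconnected E ∧ z ∈ E ∧ b ∈ E ∧ ∀ e ∈ E, (e : OnePoint ℂ) ∉ K := by
  classical
  rcases eq_or_ne z b with rfl | hzb
  · exact ⟨{z}, isPreconnected_singleton, rfl, rfl, by simpa using hz⟩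
  have hbz : b - z ≠ 0 := sub_ne_zero.2 hzb.symm
  obtain ⟨L, hL, hexp⟩ := h
  -- Send b to ∞ by u = 1/(w - b). Then K' is compact because b ∉ K, it contains 0 because ∞ ∈ K,
  -- and (w - z)/(w - b) becomes (b - z)(u - p).
  set K' : Set ℂ := recip b '' K with hK'
  have hK'c : IsCompact K' := hK.isCompact.image_of_continuousOn (continuousOn_recip hb)
  set ι : ℂ → OnePoint ℂ := fun u => if u = 0 then OnePoint.infty else ((b + u⁻¹ : ℂ) : OnePoint ℂ)
    with hι
  have hιr : ∀ w, w ≠ (b : OnePoint ℂ) → ι (recip b w) = w := by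
    intro w hw
    induction w with
    | infty => simp [hι]
    | coe w =>
      have : w - b ≠ 0 := sub_ne_zero.2 (by rintro rfl; exact hw rfl)
      simp [hι, this]
  have hιc : Continuous ι := by
    rw [continuous_iff_continuousAt]
    intro u
    rcases eq_or_ne u 0 with rfl | hu
    · rw [continuousAt_iff_punctured_nhds]
      have h1 : Tendsto (fun u : ℂ => ((b + u⁻¹ : ℂ) : OnePoint ℂ)) (𝓝[≠] 0)
          (𝓝 OnePoint.infty) := by
        have h2 : Tendsto (fun u : ℂ => b + u⁻¹) (𝓝[≠] 0) (Bornology.cobounded ℂ) :=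
          (tendsto_const_add_cobounded b).comp tendsto_inv₀_nhdsNE_zero
        have h3 := OnePoint.tendsto_coe_infty (X := ℂ)
        rw [coclosedCompact_eq_cocompact, ← Metric.cobounded_eq_cocompact] at h3
        exact h3.comp h2
      simp only [hι, if_true]
      refine h1.congr' ?_
      filter_upwards [self_mem_nhdsWithin] with u hu
      simp [show u ≠ 0 from hu]
    · have h1 : ContinuousAt (fun u : ℂ => ((b + u⁻¹ : ℂ) : OnePoint ℂ)) u :=
        (OnePoint.continuous_coe.continuousAt).comp
          (continuousAt_const.add (continuousAt_inv₀ hu))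
      refine h1.congr ?_
      filter_upwards [isOpen_ne.mem_nhds hu] with v hv
      simp [hι, hv]
  have hιK : MapsTo ι K' K := by
    rintro _ ⟨w, hw, rfl⟩
    rwa [hιr w (by rintro rfl; exact hb hw)]
  set p : ℂ := (z - b)⁻¹ with hp
  have hp0 : p ≠ 0 := inv_ne_zero (sub_ne_zero.2 hzb)
  have hpK : p ∉ K' := by
    intro h
    have h1 := hιK h
    simp [hι, hp0] at h1
    simp [hp] at h1
    exact hz h1
  have hlog : ∀ u ∈ K', Complex.exp (L (ι u) - Complex.log (b - z)) = u - p := by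
    rintro _ ⟨w, hw, rfl⟩
    rw [hιr w (by rintro rfl; exact hb hw), Complex.exp_sub, hexp w hw, Complex.exp_log hbz, hp]
    have : z - b ≠ 0 := sub_ne_zero.2 hzb
    field_simp
    ring
  have hub := not_isBounded_connectedComponentIn_of_log hK'c hpK
    ((hL.comp hιc.continuousOn hιK).sub continuousOn_const) hlog
  set U := connectedComponentIn K'ᶜ p with hU
  have hUK : U ⊆ K'ᶜ := connectedComponentIn_subset _ _
  have h0 : ∀ u ∈ U, u ≠ 0 := by
    rintro u hu rfl
    exact hUK hu ⟨_, hinf, rfl⟩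
  set A : Set ℂ := (fun u => b + u⁻¹) '' U with hA
  have hApre : IsPreconnected A := isPreconnected_connectedComponentIn.image _
    (continuousOn_const.add (continuousOn_inv₀.mono h0))
  -- Unboundedness of U in the u-coordinate says that A accumulates at b, so b may be added without
  -- losing connectedness.
  have hbA : b ∈ closure A := by
    rw [Metric.mem_closure_iff]
    intro ε hε
    by_contra! hcon
    refine hub ((Metric.isBounded_iff_subset_closedBall 0).2 ⟨ε⁻¹, fun u hu => ?_⟩)
    have := hcon _ (mem_image_of_mem _ hu)
    rw [dist_eq_norm, sub_add_cancel_left, norm_neg, norm_inv] at this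
    rw [mem_closedBall_zero_iff]
    exact (le_inv_comm₀ hε (norm_pos_iff.2 (h0 u hu))).1 this
  refine ⟨insert b A, hApre.subset_closure (subset_insert _ _) (insert_subset hbA subset_closure),
    mem_insert_of_mem _ ⟨p, mem_connectedComponentIn hpK, by simp [hp]⟩, mem_insert _ _, ?_⟩
  rintro e (rfl | ⟨u, hu, rfl⟩)
  · exact hb
  · intro h
    exact hUK hu ⟨_, h, by simp⟩

/-! ### Unbounded Jordan domains near infinity -/

theorem isPreconnected_setOf_lt_norm {M : ℝ} (hM : 0 < M) :
    IsPreconnected {w : ℂ | M < ‖w‖} := by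
  have : {w : ℂ | M < ‖w‖} = Complex.exp '' {t : ℂ | Real.log M < t.re} := by
    ext w
    simp only [mem_ofPred_eq, mem_image]
    constructor
    · intro hw
      have hw0 : w ≠ 0 := by rintro rfl; simp at hw; linarith
      exact ⟨Complex.log w, by rw [Complex.log_re]; exact Real.log_lt_log hM hw,
        Complex.exp_log hw0⟩
    · rintro ⟨t, ht, rfl⟩
      rw [Complex.norm_exp]
      exact (Real.log_lt_iff_lt_exp hM).1 ht
  rw [this]
  exact (convex_halfSpace_re_gt _).isPreconnected.image _ Complex.continuous_exp.continuousOn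

theorem subset_of_disjoint_frontier {X : Type*} [TopologicalSpace X] {E U : Set X}
    (hE : IsPreconnected E) (hU : IsOpen U) (hne : (E ∩ U).Nonempty)
    (hfr : Disjoint E (frontier U)) : E ⊆ U := by
  refine hE.subset_left_of_subset_union hU isClosed_closure.isOpen_compl
    (disjoint_compl_right.mono_left subset_closure) ?_ hne
  intro e he
  by_cases h : e ∈ closure U
  · left
    by_contra h'
    exact disjoint_left.1 hfr he (by rw [hU.frontier_eq]; exact ⟨h, h'⟩)
  · exact Or.inr h

namespace IsUnboundedJordanDomain

theorem infty_mem_frontier {V : Set ℂ} (hV : IsUnboundedJordanDomain V) :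
    OnePoint.infty ∈ frontier ((fun z : ℂ => (z : OnePoint ℂ)) '' V) := by
  have ho : IsOpen ((fun z : ℂ => (z : OnePoint ℂ)) '' V) :=
    OnePoint.isOpenMap_coe V hV.isOpen
  rw [ho.frontier_eq]
  refine ⟨?_, by simp⟩
  rw [mem_closure_iff_clusterPt, clusterPt_iff_nonempty]
  intro S hS T hT
  rw [mem_principal] at hT
  rw [OnePoint.nhds_infty_eq, mem_sup, mem_map, coclosedCompact_eq_cocompact,
    ← Metric.cobounded_eq_cocompact] at hS
  by_contra hemp
  refine hV.not_isBounded ?_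
  rw [Bornology.isBounded_def]
  filter_upwards [hS.1] with z hz hzV
  exact hemp ⟨_, hz, hT ⟨z, hzV, rfl⟩⟩

/-- An injective curve has a finite point, and this point lies on the boundary of the open set V.
The Koebe estimate needs such an omitted value. -/
theorem exists_notMem {V : Set ℂ} (hV : IsUnboundedJordanDomain V) : ∃ p : ℂ, p ∉ V := by
  obtain ⟨γ, -, hinj, hγ⟩ := hV.exists_jordan_curve
  have hne : ∃ t, γ t ≠ OnePoint.infty := by
    by_contra! h
    have h1 : (1 : Circle) = -1 := hinj ((h 1).trans (h (-1)).symm)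
    have h2 := congrArg (fun x : Circle => (x : ℂ)) h1
    norm_num at h2
  obtain ⟨t, ht⟩ := hne
  obtain ⟨p, hp⟩ := OnePoint.ne_infty_iff_exists.1 ht
  refine ⟨p, fun hpV => ?_⟩
  have hmem : γ t ∈ frontier ((fun z : ℂ => (z : OnePoint ℂ)) '' V) := hγ ▸ mem_range_self t
  rw [(OnePoint.isOpenMap_coe V hV.isOpen).frontier_eq, ← hp] at hmem
  exact hmem.2 ⟨p, hpV, rfl⟩

/-- An unbounded Jordan domain is locally connected at `∞`. -/
theorem exists_isPreconnected_near_infty {V : Set ℂ} (hV : IsUnboundedJordanDomain V) {M : ℝ}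
    (hM : 0 < M) : ∃ R, ∀ z ∈ V, ∀ b ∈ V, R < ‖z‖ → R < ‖b‖ →
      ∃ E : Set ℂ, IsPreconnected E ∧ z ∈ E ∧ b ∈ E ∧ E ⊆ V ∧ ∀ e ∈ E, M < ‖e‖ := by
  obtain ⟨γ, hγc, hinj, hγ⟩ := hV.exists_jordan_curve
  have ho : IsOpen ((fun z : ℂ => (z : OnePoint ℂ)) '' V) :=
    OnePoint.isOpenMap_coe V hV.isOpen
  obtain ⟨t₀, ht₀⟩ : OnePoint.infty ∈ range γ := hγ ▸ hV.infty_mem_frontier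
  set D : Set (OnePoint ℂ) := (fun z : ℂ => (z : OnePoint ℂ)) '' Metric.closedBall 0 M with hD
  have hDc : IsClosed D :=
    ((isCompact_closedBall (0 : ℂ) M).image OnePoint.continuous_coe).isClosed
  set δ : ℝ → OnePoint ℂ := fun θ => γ (t₀ * Circle.exp θ) with hδ
  have hδc : Continuous δ := by fun_prop
  have hδ0 : δ 0 = OnePoint.infty := by simp [hδ, ht₀]
  obtain ⟨η', hη', hηD'⟩ := Metric.isOpen_iff.1 (hDc.isOpen_compl.preimage hδc) 0
    (show δ 0 ∉ D by rw [hδ0]; simp [hD])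
  obtain ⟨η, hη, hηD⟩ : ∃ η > 0, ∀ θ, |θ| < η → δ θ ∉ D :=
    ⟨η', hη', fun θ hθ => hηD' (by simpa using hθ)⟩
  -- The Jordan curve with a short open arc about ∞ removed. The removed arc misses the disc D, so
  -- all of the curve inside D lies on J.
  set J : Set (OnePoint ℂ) := δ '' Icc η (2 * Real.pi - η) with hJ
  have hJc : IsCompact J := isCompact_Icc.image hδc
  have hJpre : IsPreconnected J := isPreconnected_Icc.image _ hδc.continuousOn
  have hJsub : J ⊆ range γ := by
    rintro _ ⟨θ, -, rfl⟩
    exact mem_range_self _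
  have hJinf : OnePoint.infty ∉ J := by
    rintro ⟨θ, hθ, h⟩
    rw [← ht₀] at h
    have h1 := hinj h
    have h2 : Circle.exp θ = 1 := by simpa using h1
    rw [Circle.exp_eq_one] at h2
    obtain ⟨n, hn⟩ := h2
    have hpi := Real.pi_pos
    have h3 : 0 < (n : ℝ) := by
      by_contra! h
      nlinarith [hθ.1]
    have h4 : (n : ℝ) < 1 := by
      by_contra! h
      nlinarith [hθ.2]
    have h5 : 0 < n := by exact_mod_cast h3
    have h6 : n < 1 := by exact_mod_cast h4
    omega
  have hDJ : range γ ∩ D ⊆ J := by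
    rintro _ ⟨⟨t, rfl⟩, ht⟩
    obtain ⟨θ, hθ, hθt⟩ : ∃ θ ∈ Ico (0 : ℝ) (2 * Real.pi), Circle.exp θ = t₀⁻¹ * t := by
      obtain ⟨θ, hθ, h⟩ := Circle.periodic_exp.exists_mem_Ico₀ Real.two_pi_pos
        (Complex.arg (t₀⁻¹ * t : Circle))
      exact ⟨θ, hθ, by rw [← h, Circle.exp_arg]⟩
    have hγt : γ t = δ θ := by simp [hδ, hθt]
    rw [hγt] at ht ⊢
    refine mem_image_of_mem _ ⟨?_, ?_⟩
    · by_contra! h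
      exact hηD θ (by rw [abs_of_nonneg hθ.1]; exact h) ht
    · by_contra! h
      refine hηD (θ - 2 * Real.pi) (by rw [abs_of_neg (by linarith [hθ.2])]; linarith) ?_
      have : δ (θ - 2 * Real.pi) = δ θ := by
        simp [hδ, Circle.exp_sub]
      rwa [this]
  -- K₁ does not separate points of V, and K₂ does not separate points of modulus greater than R
  -- once K₂ lies in the disc of radius R. Since K₁ ∩ K₂ = J is connected, K₁ ∪ K₂ does not separate
  -- points satisfying both conditions.
  set K₁ : Set (OnePoint ℂ) := range γ with hK₁
  set K₂ : Set (OnePoint ℂ) := D ∪ J with hK₂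
  have hK₁c : IsClosed K₁ := (isCompact_range hγc).isClosed
  have hK₂c : IsClosed K₂ := hDc.union hJc.isClosed
  have hK₁₂ : K₁ ∩ K₂ = J := by
    rw [hK₂, inter_union_distrib_left, inter_eq_right.2 hJsub]
    exact union_eq_right.2 hDJ
  have hJb : Bornology.IsBounded ((fun z : ℂ => (z : OnePoint ℂ)) ⁻¹' J) := by
    have h1 := ((OnePoint.isClosed_iff_of_notMem hJinf).1 hJc.isClosed).2
    exact h1.isBounded
  obtain ⟨R, hRM, hR⟩ := hJb.subset_closedBall_lt M 0
  have hK₂R : ∀ w : ℂ, R < ‖w‖ → (w : OnePoint ℂ) ∉ K₂ := by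
    rintro w hw (⟨v, hv, hvw⟩ | h)
    · obtain rfl := OnePoint.coe_injective hvw
      rw [mem_closedBall_zero_iff] at hv
      linarith
    · have := hR h
      rw [mem_closedBall_zero_iff] at this
      linarith
  have hVK₁ : ∀ z ∈ V, (z : OnePoint ℂ) ∉ K₁ := by
    intro z hz h
    rw [← hγ, ho.frontier_eq] at h
    exact h.2 ⟨z, hz, rfl⟩
  refine ⟨R, fun z hz b hb hzR hbR => ?_⟩
  have hR0 : 0 < R := hM.trans hRM
  have hlog := HasLogOn.union hK₁c hK₂c (hK₁₂ ▸ hJpre)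
    (hasLogOn_of_isPreconnected hK₁c hV.isConnected.isPreconnected hVK₁ hz hb)
    (hasLogOn_of_isPreconnected hK₂c (isPreconnected_setOf_lt_norm hR0) hK₂R hzR hbR)
  obtain ⟨E, hE, hzE, hbE, hEK⟩ := hlog.exists_isPreconnected (hK₁c.union hK₂c)
    (by simp [hVK₁ z hz, hK₂R z hzR]) (by simp [hVK₁ b hb, hK₂R b hbR])
    (Or.inl ⟨t₀, ht₀⟩)
  refine ⟨E, hE, hzE, hbE, ?_, fun e he => ?_⟩
  · have h1 := subset_of_disjoint_frontier (hE.image _ OnePoint.continuous_coe.continuousOn) ho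
      ⟨(z : OnePoint ℂ), ⟨z, hzE, rfl⟩, ⟨z, hz, rfl⟩⟩ (by
        rw [disjoint_left]
        rintro _ ⟨e, he, rfl⟩ h
        exact hEK e he (Or.inl (hγ ▸ h)))
    intro e he
    obtain ⟨v, hv, hve⟩ := h1 ⟨e, he, rfl⟩
    exact OnePoint.coe_injective hve ▸ hv
  · by_contra! h
    exact hEK e he (Or.inr (Or.inl ⟨e, by simpa using h, rfl⟩))

end IsUnboundedJordanDomain

/-! ### The strip and the length-area argument -/

/-- The horizontal strip `|Im s| < π / 2`, the image of the right half plane under `log`. -/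
def strip : Set ℂ := {s | |s.im| < Real.pi / 2}

theorem isOpen_strip : IsOpen strip :=
  isOpen_lt (by fun_prop) continuous_const

theorem mem_strip {s : ℂ} : s ∈ strip ↔ |s.im| < Real.pi / 2 := Iff.rfl

theorem ball_subset_strip {s : ℂ} {θ δ : ℝ} (hs : |s.im| ≤ θ) (hθδ : θ + δ ≤ Real.pi / 2) :
    Metric.ball s δ ⊆ strip := by
  intro z hz
  rw [Metric.mem_ball, dist_eq_norm] at hz
  have h1 : |z.im - s.im| < δ := (Complex.abs_im_le_norm (z - s)).trans_lt hz
  rw [mem_strip]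
  have h2 := abs_sub_abs_le_abs_sub z.im s.im
  linarith

open MeasureTheory in
/-- The Jacobian of a holomorphic map. -/
theorem lintegral_image_of_injOn {Φ : ℂ → ℂ} {S : Set ℂ} (hS : IsOpen S)
    (hd : DifferentiableOn ℂ Φ S) (hinj : InjOn Φ S) (g : ℂ → ENNReal) :
    ∫⁻ w in Φ '' S, g w = ∫⁻ s in S, ENNReal.ofReal (‖deriv Φ s‖ ^ 2) * g (Φ s) := by
  rw [lintegral_image_eq_lintegral_abs_det_fderiv_mul volume hS.measurableSet
    (f' := fun s => (ContinuousLinearMap.toSpanSingleton ℂ (deriv Φ s)).restrictScalars ℝ)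
    (fun s hs => ((hd.differentiableAt (hS.mem_nhds hs)).hasDerivAt.hasFDerivAt.restrictScalars
      ℝ).hasFDerivWithinAt) hinj g]
  refine setLIntegral_congr_fun hS.measurableSet fun s _ => ?_
  congr 2
  rw [ContinuousLinearMap.det]
  have : ((((ContinuousLinearMap.toSpanSingleton ℂ (deriv Φ s)).restrictScalars ℝ : ℂ →L[ℝ] ℂ)) :
      ℂ →ₗ[ℝ] ℂ) = ((LinearMap.toSpanSingleton ℂ ℂ (deriv Φ s)).restrictScalars ℝ) := rfl
  rw [this, LinearMap.det_restrictScalars]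
  simp [Complex.normSq_eq_norm_sq, Algebra.norm_complex_apply]

/-- The square of the spherical derivative. -/
noncomputable def sphSq (Φ : ℂ → ℂ) (s : ℂ) : ℝ := ‖deriv Φ s‖ ^ 2 / (1 + ‖Φ s‖ ^ 2) ^ 2

theorem sphSq_nonneg (Φ : ℂ → ℂ) (s : ℂ) : 0 ≤ sphSq Φ s := by unfold sphSq; positivity

-- By injectivity this is the spherical area of the image, up to normalisation, and the whole plane
-- has finite spherical area. The Euclidean area of the image may be infinite.
open MeasureTheory in
theorem lintegral_sphSq_lt_top {Φ : ℂ → ℂ} {S : Set ℂ} (hS : IsOpen S)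
    (hd : DifferentiableOn ℂ Φ S) (hinj : InjOn Φ S) :
    ∫⁻ s in S, ENNReal.ofReal (sphSq Φ s) < ⊤ := by
  have h := lintegral_image_of_injOn hS hd hinj
    (fun w => ENNReal.ofReal (((1 + ‖w‖ ^ 2) ^ 2)⁻¹))
  have h1 : ∫⁻ s in S, ENNReal.ofReal (sphSq Φ s) =
      ∫⁻ s in S, ENNReal.ofReal (‖deriv Φ s‖ ^ 2) *
        ENNReal.ofReal (((1 + ‖Φ s‖ ^ 2) ^ 2)⁻¹) := by
    refine lintegral_congr fun s => ?_
    rw [← ENNReal.ofReal_mul (by positivity), sphSq, div_eq_mul_inv]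
  rw [h1, ← h]
  refine (setLIntegral_le_lintegral _ _).trans_lt ?_
  have h2 : Integrable (fun w : ℂ => ((1 : ℝ) + ‖w‖ ^ 2) ^ (-(4 : ℝ) / 2)) volume :=
    integrable_rpow_neg_one_add_norm_sq (by simp; norm_num)
  have h3 : (fun w : ℂ => ((1 : ℝ) + ‖w‖ ^ 2) ^ (-(4 : ℝ) / 2)) =
      fun w => ((1 + ‖w‖ ^ 2) ^ 2)⁻¹ := by
    ext w
    rw [show (-(4 : ℝ) / 2) = -2 by norm_num, Real.rpow_neg (by positivity)]
    norm_num
  rw [h3] at h2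
  exact h2.lintegral_lt_top

open MeasureTheory in
/-- Far out in the strip there are vertical segments with small spherical Dirichlet integral. -/
theorem exists_lintegral_vertical_lt {Φ : ℂ → ℂ} (hd : DifferentiableOn ℂ Φ strip)
    (hinj : InjOn Φ strip) {ε : ENNReal} (hε : 0 < ε) :
    ∃ X₀ : ℝ, ∀ X ≥ X₀, ∃ x ∈ Icc X (X + 1),
      ∫⁻ y in Ioo (-(Real.pi / 2)) (Real.pi / 2), ENNReal.ofReal (sphSq Φ ⟨x, y⟩) < ε := by
  set I := Ioo (-(Real.pi / 2)) (Real.pi / 2) with hI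
  set F : ℂ → ENNReal := strip.indicator fun s => ENNReal.ofReal (sphSq Φ s) with hF
  have hFm : Measurable F := by
    classical
    rw [hF, ← piecewise_eq_indicator]
    refine ContinuousOn.measurable_piecewise ?_ continuousOn_const isOpen_strip.measurableSet
    refine ENNReal.continuous_ofReal.comp_continuousOn ?_
    unfold sphSq
    exact ((hd.deriv isOpen_strip).continuousOn.norm.pow 2).div
      ((continuousOn_const.add (hd.continuousOn.norm.pow 2)).pow 2) fun s _ => by positivity
  set m : ℝ → ENNReal := fun x => ∫⁻ y, F ⟨x, y⟩ with hm
  have hmI : ∀ x, m x = ∫⁻ y in I, ENNReal.ofReal (sphSq Φ ⟨x, y⟩) := by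
    intro x
    rw [← lintegral_indicator measurableSet_Ioo]
    refine lintegral_congr fun y => ?_
    simp only [hF, indicator, mem_strip, mem_Ioo, abs_lt]
  have htot : ∫⁻ x, m x < ⊤ := by
    have h1 : ∫⁻ s, F s < ⊤ := by
      rw [hF, lintegral_indicator isOpen_strip.measurableSet]
      exact lintegral_sphSq_lt_top isOpen_strip hd hinj
    rw [← (Complex.volume_preserving_equiv_real_prod.symm).lintegral_comp_emb
      Complex.measurableEquivRealProd.symm.measurableEmbedding, Measure.volume_eq_prod,
      lintegral_prod] at h1
    · exact h1
    · exact (hFm.comp Complex.measurableEquivRealProd.symm.measurable).aemeasurable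
  -- The integrals over vertical segments form an integrable density, so its tails vanish. An
  -- interval of length one on which the density is everywhere at least ε would carry mass at least
  -- ε.
  have hlim := tendsto_measure_iInter_atTop (μ := volume.withDensity m)
    (s := fun n : ℕ => Ici (n : ℝ)) (fun n => measurableSet_Ici.nullMeasurableSet)
    (fun a b hab => Ici_subset_Ici.2 (by exact_mod_cast hab)) ⟨0, by
      rw [withDensity_apply _ measurableSet_Ici]
      exact ((setLIntegral_le_lintegral _ _).trans_lt htot).ne⟩
  have hemp : ⋂ n : ℕ, Ici (n : ℝ) = ∅ := by
    rw [eq_empty_iff_forall_notMem]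
    intro x hx
    obtain ⟨n, hn⟩ := exists_nat_gt x
    exact absurd (mem_iInter.1 hx n) (by simpa using hn)
  rw [hemp, measure_empty] at hlim
  obtain ⟨N, hN⟩ := (hlim.eventually (gt_mem_nhds hε)).exists
  refine ⟨N, fun X hX => ?_⟩
  by_contra! hcon
  refine hN.not_ge ?_
  simp only [Function.comp]
  rw [withDensity_apply _ measurableSet_Ici]
  calc ε = ∫⁻ _ in Icc X (X + 1), ε := by simp
    _ ≤ ∫⁻ x in Icc X (X + 1), m x :=
        setLIntegral_mono' measurableSet_Icc fun x hx => by rw [hmI]; exact hcon x hx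
    _ ≤ ∫⁻ x in Ici (N : ℝ), m x :=
        lintegral_mono_set fun x hx => le_trans hX hx.1

/-- On a vertical segment with small spherical Dirichlet integral, the spherical distance to `∞`
varies little. -/
theorem abs_sub_le_of_lintegral_vertical {Φ : ℂ → ℂ} (hd : DifferentiableOn ℂ Φ strip)
    {x ε η : ℝ} (hε : 0 ≤ ε) (hη : 0 < η)
    (hx : ∫⁻ y in Ioo (-(Real.pi / 2)) (Real.pi / 2), ENNReal.ofReal (sphSq Φ ⟨x, y⟩) ≤
      ENNReal.ofReal ε) {y₁ y₂ : ℝ} (h₁ : -(Real.pi / 2) < y₁) (h₁₂ : y₁ ≤ y₂)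
    (h₂ : y₂ < Real.pi / 2) :
    |(1 + ‖Φ ⟨x, y₂⟩‖ ^ 2)⁻¹ - (1 + ‖Φ ⟨x, y₁⟩‖ ^ 2)⁻¹| ≤ ε / (2 * η) + η / 2 * Real.pi := by
  have hmem : ∀ y ∈ Icc y₁ y₂, (⟨x, y⟩ : ℂ) ∈ strip := fun y hy =>
    abs_lt.2 ⟨h₁.trans_le hy.1, hy.2.trans_lt h₂⟩
  have hline : ∀ y : ℝ, HasDerivAt (fun y : ℝ => (⟨x, y⟩ : ℂ)) Complex.I y := by
    intro y
    have h : (fun y : ℝ => (⟨x, y⟩ : ℂ)) = fun y : ℝ => (x : ℂ) + y * Complex.I := by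
      ext y; exact Complex.mk_eq_add_mul_I x y
    rw [h]
    simpa using ((hasDerivAt_id y).ofReal_comp.mul_const Complex.I).const_add (x : ℂ)
  have hvert : Continuous fun y : ℝ => (⟨x, y⟩ : ℂ) :=
    continuous_iff_continuousAt.2 fun y => (hline y).continuousAt
  have hc : ∀ y ∈ Icc y₁ y₂, HasDerivAt (fun y : ℝ => Φ ⟨x, y⟩) (deriv Φ ⟨x, y⟩ * Complex.I) y :=
    fun y hy => ((hd.differentiableAt
      (isOpen_strip.mem_nhds (hmem y hy))).hasDerivAt).comp y (hline y)
  have hk : ∀ y ∈ Icc y₁ y₂, HasDerivAt (fun y : ℝ => (1 + ‖Φ ⟨x, y⟩‖ ^ 2)⁻¹)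
      (-(2 * inner ℝ (Φ ⟨x, y⟩) (deriv Φ ⟨x, y⟩ * Complex.I)) / (1 + ‖Φ ⟨x, y⟩‖ ^ 2) ^ 2) y :=
    fun y hy => ((hc y hy).norm_sq.const_add 1).fun_inv (by positivity)
  have hcont : ContinuousOn (fun y : ℝ => Φ ⟨x, y⟩) (Icc y₁ y₂) :=
    fun y hy => (hc y hy).continuousAt.continuousWithinAt
  have hcont' : ContinuousOn (fun y : ℝ => deriv Φ ⟨x, y⟩) (Icc y₁ y₂) :=
    (hd.deriv isOpen_strip).continuousOn.comp hvert.continuousOn hmem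
  have hsq : ContinuousOn (fun y : ℝ => sphSq Φ ⟨x, y⟩) (Icc y₁ y₂) := by
    unfold sphSq
    exact (hcont'.norm.pow 2).div ((continuousOn_const.add (hcont.norm.pow 2)).pow 2)
      fun y _ => by positivity
  have hkc : ContinuousOn (fun y : ℝ => -(2 * inner ℝ (Φ ⟨x, y⟩) (deriv Φ ⟨x, y⟩ * Complex.I)) /
      (1 + ‖Φ ⟨x, y⟩‖ ^ 2) ^ 2) (Icc y₁ y₂) :=
    ((hcont.inner (𝕜 := ℝ) (hcont'.mul continuousOn_const)).const_smul (2 : ℝ)).neg.div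
      ((continuousOn_const.add (hcont.norm.pow 2)).pow 2) fun y _ => by positivity
  have hsqi : IntervalIntegrable (fun y : ℝ => sphSq Φ ⟨x, y⟩) MeasureTheory.volume y₁ y₂ :=
    ContinuousOn.intervalIntegrable (by rwa [uIcc_of_le h₁₂])
  have hint : ∫ y in y₁..y₂, sphSq Φ ⟨x, y⟩ ≤ ε := by
    rw [intervalIntegral.integral_of_le h₁₂, MeasureTheory.integral_eq_lintegral_of_nonneg_ae
      (Eventually.of_forall fun y => sphSq_nonneg _ _) hsqi.1.aestronglyMeasurable]
    refine ENNReal.toReal_le_of_le_ofReal hε (le_trans ?_ hx)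
    exact MeasureTheory.lintegral_mono_set fun y hy => ⟨h₁.trans hy.1, hy.2.trans_lt h₂⟩
  rw [← intervalIntegral.integral_eq_sub_of_hasDerivAt (a := y₁) (b := y₂)
    (f := fun y : ℝ => (1 + ‖Φ ⟨x, y⟩‖ ^ 2)⁻¹)
    (by rw [uIcc_of_le h₁₂]; exact hk)
    (ContinuousOn.intervalIntegrable (by rwa [uIcc_of_le h₁₂]))]
  -- The derivative of 1/(1 + |Φ|²) is at most the spherical derivative v, as 2a ≤ 1 + a². The
  -- inequality v ≤ v²/(2η) + η/2 then replaces Cauchy-Schwarz.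
  have hbound : ∀ y ∈ Ioc y₁ y₂,
      ‖-(2 * inner ℝ (Φ ⟨x, y⟩) (deriv Φ ⟨x, y⟩ * Complex.I)) / (1 + ‖Φ ⟨x, y⟩‖ ^ 2) ^ 2‖ ≤
        sphSq Φ ⟨x, y⟩ / (2 * η) + η / 2 := by
    intro y _
    have h1 : |inner ℝ (Φ ⟨x, y⟩) (deriv Φ ⟨x, y⟩ * Complex.I)| ≤
        ‖Φ ⟨x, y⟩‖ * ‖deriv Φ ⟨x, y⟩‖ := by
      simpa using abs_real_inner_le_norm (Φ ⟨x, y⟩) (deriv Φ ⟨x, y⟩ * Complex.I)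
    set a := ‖Φ ⟨x, y⟩‖ with ha
    set d := ‖deriv Φ ⟨x, y⟩‖ with hdd
    have hd0 : 0 ≤ d := norm_nonneg _
    set v := d / (1 + a ^ 2) with hv
    have hv2 : sphSq Φ ⟨x, y⟩ = v ^ 2 := by rw [sphSq, hv, div_pow]
    have h2 : ‖-(2 * inner ℝ (Φ ⟨x, y⟩) (deriv Φ ⟨x, y⟩ * Complex.I)) / (1 + a ^ 2) ^ 2‖ ≤ v := by
      rw [norm_div, norm_neg, norm_mul, Real.norm_eq_abs, Real.norm_eq_abs, Real.norm_eq_abs,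
        abs_of_pos (by positivity : (0 : ℝ) < (1 + a ^ 2) ^ 2), abs_two, hv,
        div_le_div_iff₀ (by positivity) (by positivity)]
      have h3 : 2 * (a * d) ≤ (1 + a ^ 2) * d := by nlinarith [sq_nonneg (a - 1)]
      calc _ ≤ 2 * (a * d) * (1 + a ^ 2) := by gcongr
        _ ≤ (1 + a ^ 2) * d * (1 + a ^ 2) := by gcongr
        _ = _ := by ring
    refine h2.trans ?_
    rw [hv2, div_add_div _ _ (by positivity) (by norm_num), le_div_iff₀ (by positivity)]
    nlinarith [sq_nonneg (v - η)]
  have h := intervalIntegral.norm_integral_le_of_norm_le h₁₂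
    (Eventually.of_forall hbound) (g := fun y => sphSq Φ ⟨x, y⟩ / (2 * η) + η / 2)
    ((hsqi.div_const _).add intervalIntegrable_const)
  refine h.trans ?_
  rw [intervalIntegral.integral_add (hsqi.div_const _) intervalIntegrable_const,
    intervalIntegral.integral_div, intervalIntegral.integral_const, smul_eq_mul]
  rw [mul_comm (η / 2) Real.pi]
  gcongr
  linarith

/-- If every vertical segment far out contains points with large image, then the map tends to
`∞` inside smaller strips. -/
theorem exists_forall_lt_norm_of_strip {Φ : ℂ → ℂ} (hd : DifferentiableOn ℂ Φ strip)
    (hinj : InjOn Φ strip) {p : ℂ} (hp : ∀ s ∈ strip, Φ s ≠ p)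
    (hlarge : ∀ M : ℝ, ∃ x₀, ∀ x ≥ x₀, ∃ s ∈ strip, s.re = x ∧ M < ‖Φ s‖)
    {θ : ℝ} (hθ : θ < Real.pi / 2) (M : ℝ) :
    ∃ X, ∀ s : ℂ, X ≤ s.re → |s.im| ≤ θ → M < ‖Φ s‖ := by
  set δ := Real.pi / 2 - θ with hδ
  have hδ0 : 0 < δ := sub_pos.2 hθ
  -- Being beyond A on a nearby vertical segment is what survives the loss of a factor exp(500/δ)
  -- when moving horizontally by at most 1. The level κ expresses |Φ| = A in terms of 1/(1 + |Φ|²).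
  set M' := |M| + 1 + ‖p‖ with hM'
  set A := ‖p‖ + M' * Real.exp (500 / δ) with hA
  set κ := (1 + A ^ 2)⁻¹ with hκ
  have hκ0 : 0 < κ := by positivity
  have hM'0 : 0 < M' := by positivity
  have hA0 : 0 < A := by positivity
  obtain ⟨X₁, hX₁⟩ := exists_lintegral_vertical_lt hd hinj
    (ENNReal.ofReal_pos.2 (by positivity : 0 < κ ^ 2 / 32))
  obtain ⟨B, hB0, hB⟩ : ∃ B : ℝ, 0 < B ∧ (1 + B ^ 2)⁻¹ ≤ κ / 2 := by
    refine ⟨2 * (A + 1), by positivity, ?_⟩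
    rw [hκ, inv_eq_one_div, inv_eq_one_div, div_div, div_le_div_iff₀ (by positivity) (by positivity)]
    nlinarith
  obtain ⟨X₂, hX₂⟩ := hlarge B
  refine ⟨max X₁ X₂, fun s hs hsθ => ?_⟩
  obtain ⟨x, hx, hxint⟩ := hX₁ s.re ((le_max_left _ _).trans hs)
  obtain ⟨s₀, hs₀, hs₀x, hs₀B⟩ := hX₂ x (((le_max_right _ _).trans hs).trans hx.1)
  have hsim : |s.im| < Real.pi / 2 := hsθ.trans_lt hθ
  have hclose : |(1 + ‖Φ ⟨x, s.im⟩‖ ^ 2)⁻¹ - (1 + ‖Φ s₀‖ ^ 2)⁻¹| < κ / 2 := by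
    have hs₀e : s₀ = ⟨x, s₀.im⟩ := Complex.ext hs₀x rfl
    have hs₀' := abs_lt.1 (mem_strip.1 hs₀)
    have hnum : κ ^ 2 / 32 / (2 * (κ / 8)) + κ / 8 / 2 * Real.pi < κ / 2 := by
      have h1 : κ ^ 2 / 32 / (2 * (κ / 8)) = κ / 8 := by field_simp; norm_num
      rw [h1]
      nlinarith [Real.pi_lt_d2]
    rw [hs₀e]
    rcases le_total s₀.im s.im with h | h
    · exact (abs_sub_le_of_lintegral_vertical hd (by positivity) (by positivity : 0 < κ / 8)
        hxint.le hs₀'.1 h (abs_lt.1 hsim).2).trans_lt hnum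
    · rw [abs_sub_comm]
      exact (abs_sub_le_of_lintegral_vertical hd (by positivity) (by positivity : 0 < κ / 8)
        hxint.le (abs_lt.1 hsim).1 h hs₀'.2).trans_lt hnum
  have hfar : A < ‖Φ ⟨x, s.im⟩‖ := by
    have h1 : (1 + ‖Φ s₀‖ ^ 2)⁻¹ ≤ κ / 2 := by
      refine le_trans ?_ hB
      gcongr
    have h2 : (1 + ‖Φ ⟨x, s.im⟩‖ ^ 2)⁻¹ < κ := by
      have := (abs_lt.1 hclose).2
      linarith
    rw [hκ, inv_lt_inv₀ (by positivity) (by positivity)] at h2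
    exact lt_of_pow_lt_pow_left₀ 2 (norm_nonneg _) (by linarith)
  -- The Koebe estimate says that |Φ - p| has logarithmic derivative at most 500/δ along the
  -- horizontal segment, and Grönwall integrates this.
  have hgron : ‖Φ ⟨x, s.im⟩ - p‖ ≤ ‖Φ s - p‖ * Real.exp (500 / δ) := by
    have hder : ∀ u : ℝ, HasDerivAt (fun u : ℝ => Φ ⟨u, s.im⟩ - p) (deriv Φ ⟨u, s.im⟩) u := by
      intro u
      have hline : HasDerivAt (fun u : ℝ => (⟨u, s.im⟩ : ℂ)) 1 u := by
        have h : (fun u : ℝ => (⟨u, s.im⟩ : ℂ)) = fun u : ℝ => (u : ℂ) + s.im * Complex.I := by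
          ext u; exact Complex.mk_eq_add_mul_I u s.im
        rw [h]
        exact (hasDerivAt_id u).ofReal_comp.add_const _
      have h2 : HasDerivAt Φ (deriv Φ ⟨u, s.im⟩) (⟨u, s.im⟩ : ℂ) :=
        (hd.differentiableAt (isOpen_strip.mem_nhds
          (show (⟨u, s.im⟩ : ℂ) ∈ strip from hsim))).hasDerivAt
      simpa using (h2.comp u hline).sub_const p
    have h := norm_le_gronwallBound_of_norm_deriv_right_le (a := s.re) (b := x)
      (f := fun u : ℝ => Φ ⟨u, s.im⟩ - p) (f' := fun u : ℝ => deriv Φ ⟨u, s.im⟩)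
      (δ := ‖Φ s - p‖) (K := 500 / δ) (ε := 0)
      (fun u _ => (hder u).continuousAt.continuousWithinAt)
      (fun u _ => (hder u).hasDerivWithinAt) le_rfl (fun u _ => by
        rw [add_zero]
        have hb : Metric.ball (⟨u, s.im⟩ : ℂ) δ ⊆ strip :=
          ball_subset_strip (θ := θ) hsθ (by rw [hδ]; linarith)
        exact norm_deriv_le_of_injOn_ball hδ0 (hd.mono hb) (hinj.mono hb)
          fun z hz => hp z (hb hz)) x ⟨hx.1, le_rfl⟩
    rw [gronwallBound_ε0] at h
    refine h.trans ?_
    gcongr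
    have : 0 < 500 / δ := by positivity
    nlinarith [hx.2]
  have h1 : M' * Real.exp (500 / δ) < ‖Φ s - p‖ * Real.exp (500 / δ) := by
    refine lt_of_lt_of_le ?_ hgron
    have := norm_sub_norm_le (Φ ⟨x, s.im⟩) p
    linarith
  have h2 : M' < ‖Φ s - p‖ := lt_of_mul_lt_mul_right h1 (Real.exp_pos _).le
  have h3 := norm_sub_le (Φ s) p
  have h4 := le_abs_self M
  linarith

/-- For a conformal map of an unbounded Jordan domain fixing `∞`, every vertical segment far out
in the strip contains points with large image under the inverse. -/
theorem exists_large_of_jordan {V : Set ℂ} (hV : IsUnboundedJordanDomain V) {Ψ Φ : ℂ → ℂ}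
    (hΨ : ContinuousOn Ψ V) (hmaps : MapsTo Ψ V rightHalfPlane) (hinf : FixesInfinity Ψ V)
    (hΦ : ∀ z ∈ V, Φ (Complex.log (Ψ z)) = z) (M : ℝ) :
    ∃ x₀, ∀ x ≥ x₀, ∃ s ∈ strip, s.re = x ∧ M < ‖Φ s‖ := by
  obtain ⟨R, hR⟩ := hV.exists_isPreconnected_near_infty (M := |M| + 1) (by positivity)
  have hlarge : ∀ N : ℝ, ∃ z ∈ V, R < ‖z‖ ∧ N < ‖Ψ z‖ := by
    intro N
    have h1 : {w : ℂ | N < ‖w‖} ∈ Bornology.cobounded ℂ := by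
      filter_upwards [tendsto_norm_cobounded_atTop.eventually_gt_atTop N] with w hw using hw
    have h2 := mem_inf_principal.1 (hinf h1)
    by_contra! hcon
    refine hV.not_isBounded ?_
    rw [Bornology.isBounded_def]
    filter_upwards [h2, tendsto_norm_cobounded_atTop.eventually_gt_atTop R] with z hz hzR hzV
    exact (hcon z hzV hzR).not_gt (hz hzV)
  obtain ⟨z₀, hz₀, hz₀R, -⟩ := hlarge 0
  have hpos : ∀ z ∈ V, Ψ z ≠ 0 := by
    intro z hz h
    have := hmaps hz
    simp [rightHalfPlane, h] at this
  refine ⟨Real.log ‖Ψ z₀‖, fun x hx => ?_⟩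
  obtain ⟨z, hz, hzR, hzx⟩ := hlarge (Real.exp x)
  obtain ⟨E, hE, hz₀E, hzE, hEV, hEM⟩ := hR z₀ hz₀ z hz hz₀R hzR
  have h1 : ‖Ψ z₀‖ ≤ Real.exp x := (Real.log_le_iff_le_exp (norm_pos_iff.2 (hpos z₀ hz₀))).1 hx
  -- E joins z₀ to z in V outside a large disc, and |Ψ| runs from at most e^x to more than e^x along
  -- it.
  obtain ⟨e, he, hex⟩ := hE.intermediate_value hz₀E hzE (hΨ.mono hEV).norm ⟨h1, hzx.le⟩
  refine ⟨Complex.log (Ψ e), ?_, ?_, ?_⟩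
  · rw [mem_strip, Complex.log_im]
    exact Complex.abs_arg_lt_pi_div_two_iff.2 (Or.inl (hmaps (hEV he)))
  · simp only at hex
    rw [Complex.log_re, hex, Real.log_exp]
  · rw [hΦ e (hEV he)]
    have := hEM e he
    have := le_abs_self M
    linarith

/-! ### Cauchy integrals in strip coordinates -/

theorem mem_strip_mk {t y : ℝ} : ((t : ℂ) + y * Complex.I) ∈ strip ↔ |y| < Real.pi / 2 := by
  simp [mem_strip]

/-- The Cauchy kernel of `F ∘ Φ⁻¹`, written in the coordinates of the strip. -/
noncomputable def kernel (Φ F : ℂ → ℂ) (z s : ℂ) : ℂ := F s * deriv Φ s / (Φ s - z)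

/-- The Koebe estimate removes both Φ' and Φ - z from the bound. What is left depends only on F and
on the radius of a disc where Φ omits z. -/
theorem norm_kernel_le {Φ F : ℂ → ℂ} (hd : DifferentiableOn ℂ Φ strip) (hinj : InjOn Φ strip)
    {δ : ℝ} (hδ : 0 < δ) {z s : ℂ} (hs : Metric.ball s δ ⊆ strip)
    (hz : ∀ u ∈ Metric.ball s δ, Φ u ≠ z) : ‖kernel Φ F z s‖ ≤ 500 / δ * ‖F s‖ := by
  have h := norm_deriv_le_of_injOn_ball hδ (hd.mono hs) (hinj.mono hs) hz
  have h0 : 0 < ‖Φ s - z‖ := norm_pos_iff.2 (sub_ne_zero.2 (hz s (Metric.mem_ball_self hδ)))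
  rw [kernel, norm_div, norm_mul, div_le_iff₀ h0]
  calc ‖F s‖ * ‖deriv Φ s‖ ≤ ‖F s‖ * (500 / δ * ‖Φ s - z‖) := by gcongr
    _ = _ := by ring

section Edge

open MeasureTheory

variable {Φ F : ℂ → ℂ} {δ : ℝ} {σ : ℝ → ℂ} {T : Set ℝ}

theorem aestronglyMeasurable_kernel (hd : DifferentiableOn ℂ Φ strip)
    (hF : ContinuousOn F strip) (hσ : Continuous σ) (hT : MeasurableSet T)
    (hσT : ∀ t ∈ T, σ t ∈ strip) {z : ℂ} (hz : ∀ t ∈ T, Φ (σ t) ≠ z) :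
    AEStronglyMeasurable (fun t => kernel Φ F z (σ t)) (volume.restrict T) := by
  refine ContinuousOn.aestronglyMeasurable ?_ hT
  have h1 : ContinuousOn (kernel Φ F z) (strip ∩ {s | Φ s ≠ z}) := by
    unfold kernel
    exact ((hF.mono inter_subset_left).mul ((hd.deriv isOpen_strip).continuousOn.mono
      inter_subset_left)).div ((hd.continuousOn.mono inter_subset_left).sub continuousOn_const)
      fun s hs => sub_ne_zero.2 hs.2
  exact h1.comp hσ.continuousOn fun t ht => ⟨hσT t ht, hz t ht⟩

theorem integrableOn_kernel (hd : DifferentiableOn ℂ Φ strip) (hinj : InjOn Φ strip)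
    (hF : ContinuousOn F strip) (hδ : 0 < δ) (hσ : Continuous σ) (hT : MeasurableSet T)
    (hσT : ∀ t ∈ T, Metric.ball (σ t) δ ⊆ strip) (hFi : IntegrableOn (fun t => F (σ t)) T)
    {z : ℂ} (hz : ∀ t ∈ T, ∀ s ∈ Metric.ball (σ t) δ, Φ s ≠ z) :
    IntegrableOn (fun t => kernel Φ F z (σ t)) T ∧
      ‖∫ t in T, kernel Φ F z (σ t)‖ ≤ 500 / δ * ∫ t in T, ‖F (σ t)‖ := by
  have hb : ∀ᵐ t ∂volume.restrict T, ‖kernel Φ F z (σ t)‖ ≤ 500 / δ * ‖F (σ t)‖ := by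
    filter_upwards [ae_restrict_mem hT] with t ht
    exact norm_kernel_le hd hinj hδ (hσT t ht) (hz t ht)
  refine ⟨(hFi.norm.const_mul (500 / δ)).mono' (aestronglyMeasurable_kernel hd hF hσ hT
    (fun t ht => hσT t ht (Metric.mem_ball_self hδ))
    fun t ht => hz t ht _ (Metric.mem_ball_self hδ)) hb, ?_⟩
  rw [← integral_const_mul]
  exact norm_integral_le_of_norm_le (hFi.norm.const_mul (500 / δ)) hb

/-- Differentiation under the integral: the z-derivative of the kernel is the kernel divided by Φ -
z, and Φ∘σ stays at a fixed distance from each small disc in A. -/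
theorem differentiableOn_integral_kernel (hd : DifferentiableOn ℂ Φ strip) (hinj : InjOn Φ strip)
    (hF : ContinuousOn F strip) (hδ : 0 < δ) (hσ : Continuous σ) (hT : MeasurableSet T)
    (hσT : ∀ t ∈ T, Metric.ball (σ t) δ ⊆ strip) (hFi : IntegrableOn (fun t => F (σ t)) T)
    {A : Set ℂ} (hA : IsOpen A) (hAT : ∀ t ∈ T, ∀ s ∈ Metric.ball (σ t) δ, Φ s ∉ A) :
    DifferentiableOn ℂ (fun z => ∫ t in T, kernel Φ F z (σ t)) A := by
  intro z₀ hz₀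
  apply DifferentiableAt.differentiableWithinAt
  obtain ⟨r, hr, hrA⟩ := Metric.isOpen_iff.1 hA z₀ hz₀
  have hσT' : ∀ t ∈ T, σ t ∈ strip := fun t ht => hσT t ht (Metric.mem_ball_self hδ)
  have hne : ∀ z ∈ A, ∀ t ∈ T, Φ (σ t) ≠ z := fun z hz t ht h =>
    hAT t ht _ (Metric.mem_ball_self hδ) (h ▸ hz)
  have hsub : Metric.ball z₀ (r / 2) ⊆ A :=
    (Metric.ball_subset_ball (by linarith)).trans hrA
  have hfar : ∀ z ∈ Metric.ball z₀ (r / 2), ∀ t ∈ T, r / 2 ≤ ‖Φ (σ t) - z‖ := by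
    intro z hz t ht
    by_contra! h
    refine hAT t ht _ (Metric.mem_ball_self hδ) (hrA ?_)
    have h1 := dist_triangle (Φ (σ t)) z z₀
    rw [Metric.mem_ball] at hz ⊢
    rw [← dist_eq_norm] at h
    linarith
  refine (hasDerivAt_integral_of_dominated_loc_of_deriv_le (μ := volume.restrict T)
    (F := fun z t => kernel Φ F z (σ t))
    (F' := fun z t => kernel Φ F z (σ t) / (Φ (σ t) - z))
    (bound := fun t => 500 / δ * ‖F (σ t)‖ / (r / 2))
    (Metric.ball_mem_nhds z₀ (half_pos hr)) ?_ ?_ ?_ ?_ ?_ ?_).2.differentiableAt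
  · filter_upwards [hA.mem_nhds hz₀] with z hz
    exact aestronglyMeasurable_kernel hd hF hσ hT hσT' (hne z hz)
  · exact (integrableOn_kernel hd hinj hF hδ hσ hT hσT hFi
      fun t ht s hs h => hAT t ht s hs (h ▸ hz₀)).1
  · exact (aestronglyMeasurable_kernel hd hF hσ hT hσT' (hne z₀ hz₀)).div₀
      (ContinuousOn.aestronglyMeasurable
        ((hd.continuousOn.comp hσ.continuousOn hσT').sub continuousOn_const) hT)
  · filter_upwards [ae_restrict_mem hT] with t ht z hz
    rw [norm_div]
    have h1 := norm_kernel_le (F := F) hd hinj hδ (hσT t ht)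
      (fun u hu h => hAT t ht u hu (h ▸ hsub hz))
    have h2 := hfar z hz t ht
    gcongr
  · exact (hFi.norm.const_mul (500 / δ)).div_const _
  · filter_upwards [ae_restrict_mem hT] with t ht z hz
    have h0 : Φ (σ t) - z ≠ 0 := sub_ne_zero.2 (hne z (hsub hz) t ht)
    have h1 : HasDerivAt (fun z => Φ (σ t) - z) (-1) z := by
      simpa using (hasDerivAt_id z).const_sub (Φ (σ t))
    unfold kernel
    refine ((hasDerivAt_const z (F (σ t) * deriv Φ (σ t))).fun_div h1 h0).congr_deriv ?_
    field_simp
    ring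

end Edge

/-! ### Rectangle integrals and the residue theorem -/

section Rectangle

/-- The integral of `f` over the boundary of a rectangle, counterclockwise. -/
noncomputable def rectIntegral (f : ℂ → ℂ) (a b c d : ℝ) : ℂ :=
  (∫ x in a..b, f (x + c * Complex.I)) - (∫ x in a..b, f (x + d * Complex.I)) +
    Complex.I * (∫ y in c..d, f (b + y * Complex.I)) -
    Complex.I * (∫ y in c..d, f (a + y * Complex.I))

theorem rectIntegral_eq_zero {f : ℂ → ℂ} {a b c d : ℝ} (hab : a ≤ b) (hcd : c ≤ d)
    (hf : ∀ s : ℂ, s.re ∈ Icc a b → s.im ∈ Icc c d → DifferentiableAt ℂ f s) :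
    rectIntegral f a b c d = 0 := by
  have h := Complex.integral_boundary_rect_eq_zero_of_differentiableOn f ⟨a, c⟩ ⟨b, d⟩ (by
    intro s hs
    rw [uIcc_of_le hab, uIcc_of_le hcd] at hs
    exact (hf s hs.1 hs.2).differentiableWithinAt)
  simpa [rectIntegral] using h

theorem rectIntegral_add {f g : ℂ → ℂ} {a b c d : ℝ} (hab : a ≤ b) (hcd : c ≤ d)
    (hf : ∀ s : ℂ, s.re ∈ Icc a b → s.im ∈ Icc c d → (s.re = a ∨ s.re = b ∨ s.im = c ∨ s.im = d) →
      ContinuousAt f s)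
    (hg : ∀ s : ℂ, s.re ∈ Icc a b → s.im ∈ Icc c d → (s.re = a ∨ s.re = b ∨ s.im = c ∨ s.im = d) →
      ContinuousAt g s) :
    rectIntegral (fun s => f s + g s) a b c d = rectIntegral f a b c d + rectIntegral g a b c d := by
  have hor : ∀ (k : ℂ → ℂ) (y : ℝ), (∀ s : ℂ, s.re ∈ Icc a b → s.im = y → ContinuousAt k s) →
      IntervalIntegrable (fun x : ℝ => k (x + y * Complex.I)) MeasureTheory.volume a b := by
    intro k y hk
    refine ContinuousOn.intervalIntegrable fun x hx => ContinuousAt.continuousWithinAt ?_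
    rw [uIcc_of_le hab] at hx
    exact ContinuousAt.comp (f := fun x : ℝ => (x + y * Complex.I : ℂ))
      (hk _ (by simpa using hx) (by simp)) (by fun_prop)
  have hver : ∀ (k : ℂ → ℂ) (x : ℝ), (∀ s : ℂ, s.im ∈ Icc c d → s.re = x → ContinuousAt k s) →
      IntervalIntegrable (fun y : ℝ => k (x + y * Complex.I)) MeasureTheory.volume c d := by
    intro k x hk
    refine ContinuousOn.intervalIntegrable fun y hy => ContinuousAt.continuousWithinAt ?_
    rw [uIcc_of_le hcd] at hy
    exact ContinuousAt.comp (f := fun y : ℝ => (x + y * Complex.I : ℂ))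
      (hk _ (by simpa using hy) (by simp)) (by fun_prop)
  have hla := left_mem_Icc.2 hab
  have hrb := right_mem_Icc.2 hab
  have hlc := left_mem_Icc.2 hcd
  have hrd := right_mem_Icc.2 hcd
  unfold rectIntegral
  rw [intervalIntegral.integral_add (hor f c fun s h1 h2 => hf s h1 (h2 ▸ hlc) (by simp [h2]))
      (hor g c fun s h1 h2 => hg s h1 (h2 ▸ hlc) (by simp [h2])),
    intervalIntegral.integral_add (hor f d fun s h1 h2 => hf s h1 (h2 ▸ hrd) (by simp [h2]))
      (hor g d fun s h1 h2 => hg s h1 (h2 ▸ hrd) (by simp [h2])),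
    intervalIntegral.integral_add (hver f b fun s h1 h2 => hf s (h2 ▸ hrb) h1 (by simp [h2]))
      (hver g b fun s h1 h2 => hg s (h2 ▸ hrb) h1 (by simp [h2])),
    intervalIntegral.integral_add (hver f a fun s h1 h2 => hf s (h2 ▸ hla) h1 (by simp [h2]))
      (hver g a fun s h1 h2 => hg s (h2 ▸ hla) h1 (by simp [h2]))]
  ring

theorem rectIntegral_const_mul (k : ℂ) (f : ℂ → ℂ) (a b c d : ℝ) :
    rectIntegral (fun s => k * f s) a b c d = k * rectIntegral f a b c d := by
  unfold rectIntegral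
  simp only [intervalIntegral.integral_const_mul]
  ring

theorem log_neg_of_im_pos {v : ℂ} (hv : 0 < v.im) :
    Complex.log (-v) = Complex.log v - Real.pi * Complex.I := by
  apply Complex.ext
  · simp [Complex.log_re]
  · simp [Complex.log_im, Complex.arg_neg_eq_arg_sub_pi_of_im_pos hv]

theorem log_neg_of_im_neg {v : ℂ} (hv : v.im < 0) :
    Complex.log (-v) = Complex.log v + Real.pi * Complex.I := by
  apply Complex.ext
  · simp [Complex.log_re]
  · simp [Complex.log_im, Complex.arg_neg_eq_arg_add_pi_of_im_neg hv]

/-- The winding number of a rectangle about an interior point. -/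
theorem rectIntegral_inv_sub {a b c d : ℝ} {s₀ : ℂ} (ha : a < s₀.re) (hb : s₀.re < b)
    (hc : c < s₀.im) (hd : s₀.im < d) :
    rectIntegral (fun s => (s - s₀)⁻¹) a b c d = 2 * Real.pi * Complex.I := by
  have hor : ∀ y : ℝ, y ≠ s₀.im → ∫ x in a..b, ((x + y * Complex.I : ℂ) - s₀)⁻¹ =
      Complex.log (b + y * Complex.I - s₀) - Complex.log (a + y * Complex.I - s₀) := by
    intro y hy
    have him : ∀ x : ℝ, (x + y * Complex.I - s₀).im ≠ 0 := fun x => by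
      simpa [sub_eq_zero] using hy
    have hd : ∀ x : ℝ, HasDerivAt (fun x : ℝ => Complex.log (x + y * Complex.I - s₀))
        ((x + y * Complex.I : ℂ) - s₀)⁻¹ x := by
      intro x
      have h1 : HasDerivAt (fun x : ℝ => (x + y * Complex.I - s₀ : ℂ)) 1 x :=
        ((hasDerivAt_id x).ofReal_comp.add_const _).sub_const _
      simpa using h1.clog_real (Or.inr (him x))
    refine intervalIntegral.integral_eq_sub_of_hasDerivAt (fun x _ => hd x) ?_
    refine Continuous.intervalIntegrable ?_ _ _
    exact Continuous.inv₀ (by fun_prop) fun x h => him x (by rw [h]; rfl)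
  have hverb : Complex.I * ∫ y in c..d, ((b + y * Complex.I : ℂ) - s₀)⁻¹ =
      Complex.log (b + d * Complex.I - s₀) - Complex.log (b + c * Complex.I - s₀) := by
    have hre : ∀ y : ℝ, 0 < (b + y * Complex.I - s₀).re := fun y => by simpa using hb
    rw [← intervalIntegral.integral_const_mul]
    have hd : ∀ y : ℝ, HasDerivAt (fun y : ℝ => Complex.log (b + y * Complex.I - s₀))
        (Complex.I * ((b + y * Complex.I : ℂ) - s₀)⁻¹) y := by
      intro y
      have h1 : HasDerivAt (fun y : ℝ => (b + y * Complex.I - s₀ : ℂ)) Complex.I y := by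
        simpa using (((hasDerivAt_id y).ofReal_comp.mul_const Complex.I).const_add (b : ℂ)).sub_const s₀
      simpa [div_eq_mul_inv] using h1.clog_real (Or.inl (hre y))
    refine intervalIntegral.integral_eq_sub_of_hasDerivAt (fun x _ => hd x) ?_
    refine Continuous.intervalIntegrable ?_ _ _
    exact continuous_const.mul (Continuous.inv₀ (by fun_prop)
      fun y h => (hre y).ne' (by rw [h]; rfl))
  -- The left side crosses the cut of the principal logarithm, so the branch log(-v) is used.
  -- Returning to log v at the two left corners produces πi twice.
  have hvera : Complex.I * ∫ y in c..d, ((a + y * Complex.I : ℂ) - s₀)⁻¹ =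
      Complex.log (-(a + d * Complex.I - s₀)) - Complex.log (-(a + c * Complex.I - s₀)) := by
    have hre : ∀ y : ℝ, 0 < (-(a + y * Complex.I - s₀)).re := fun y => by simpa using ha
    rw [← intervalIntegral.integral_const_mul]
    have hd : ∀ y : ℝ, HasDerivAt (fun y : ℝ => Complex.log (-(a + y * Complex.I - s₀)))
        (Complex.I * ((a + y * Complex.I : ℂ) - s₀)⁻¹) y := by
      intro y
      have h1 : HasDerivAt (fun y : ℝ => (-(a + y * Complex.I - s₀) : ℂ)) (-Complex.I) y := by
        simpa using ((((hasDerivAt_id y).ofReal_comp.mul_const Complex.I).const_add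
          (a : ℂ)).sub_const s₀).fun_neg
      have h2 := h1.clog_real (Or.inl (hre y))
      rwa [neg_div_neg_eq, div_eq_mul_inv] at h2
    refine intervalIntegral.integral_eq_sub_of_hasDerivAt (fun x _ => hd x) ?_
    refine Continuous.intervalIntegrable ?_ _ _
    exact continuous_const.mul (Continuous.inv₀ (by fun_prop)
      fun y h => (hre y).ne' (by rw [h]; simp))
  rw [rectIntegral, hor c hc.ne, hor d hd.ne', hverb, hvera,
    log_neg_of_im_pos (by simpa using hd), log_neg_of_im_neg (by simpa using hc)]
  ring

end Rectangle

/-- The chain rule for the holomorphic inverse gives a product of derivatives equal to 1. -/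
theorem deriv_ne_zero_of_injOn {Φ : ℂ → ℂ} {S : Set ℂ} (hS : IsOpen S)
    (hd : DifferentiableOn ℂ Φ S) (hinj : InjOn Φ S) {s : ℂ} (hs : s ∈ S) : deriv Φ s ≠ 0 := by
  have hl : LeftInvOn (Function.invFunOn Φ S) Φ S := hinj.leftInvOn_invFunOn
  obtain ⟨hopen, hd'⟩ := differentiableOn_of_leftInvOn hS hd hinj hl
  intro h0
  have h1 : HasDerivAt Φ (deriv Φ s) s := (hd.differentiableAt (hS.mem_nhds hs)).hasDerivAt
  have h2 := (hd'.differentiableAt ((hopen S subset_rfl hS).mem_nhds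
    (mem_image_of_mem Φ hs))).hasDerivAt.comp s h1
  rw [h0, mul_zero] at h2
  have h3 : HasDerivAt (Function.invFunOn Φ S ∘ Φ) 1 s := by
    refine (hasDerivAt_id s).congr_of_eventuallyEq ?_
    filter_upwards [hS.mem_nhds hs] with y hy using hl hy
  exact zero_ne_one (h2.unique h3)

theorem rectIntegral_congr {f g : ℂ → ℂ} {a b c d : ℝ} (hab : a ≤ b) (hcd : c ≤ d)
    (h : ∀ s : ℂ, s.re ∈ Icc a b → s.im ∈ Icc c d →
      (s.re = a ∨ s.re = b ∨ s.im = c ∨ s.im = d) → f s = g s) :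
    rectIntegral f a b c d = rectIntegral g a b c d := by
  have hla := left_mem_Icc.2 hab
  have hrb := right_mem_Icc.2 hab
  have hlc := left_mem_Icc.2 hcd
  have hrd := right_mem_Icc.2 hcd
  have hor : ∀ y ∈ Icc c d, (y = c ∨ y = d) → ∫ x in a..b, f (x + y * Complex.I) =
      ∫ x in a..b, g (x + y * Complex.I) := by
    intro y hy hyc
    refine intervalIntegral.integral_congr fun x hx => ?_
    rw [uIcc_of_le hab] at hx
    refine h _ (by simpa using hx) (by simpa using hy) ?_
    rcases hyc with rfl | rfl <;> simp
  have hver : ∀ x ∈ Icc a b, (x = a ∨ x = b) → ∫ y in c..d, f (x + y * Complex.I) =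
      ∫ y in c..d, g (x + y * Complex.I) := by
    intro x hx hxc
    refine intervalIntegral.integral_congr fun y hy => ?_
    rw [uIcc_of_le hcd] at hy
    refine h _ (by simpa using hx) (by simpa using hy) ?_
    rcases hxc with rfl | rfl <;> simp
  unfold rectIntegral
  rw [hor c hlc (Or.inl rfl), hor d hrd (Or.inr rfl), hver a hla (Or.inl rfl),
    hver b hrb (Or.inr rfl)]

theorem kernel_differentiableAt {Φ F : ℂ → ℂ} (hd : DifferentiableOn ℂ Φ strip)
    (hF : Differentiable ℂ F) {z s : ℂ} (hs : s ∈ strip) (hz : Φ s ≠ z) :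
    DifferentiableAt ℂ (kernel Φ F z) s := by
  have h1 := hd.differentiableAt (isOpen_strip.mem_nhds hs)
  have h2 := (hd.deriv isOpen_strip).differentiableAt (isOpen_strip.mem_nhds hs)
  exact ((hF s).mul h2).div (h1.sub_const z) (sub_ne_zero.2 hz)

/-- The residue theorem for the Cauchy kernel on a rectangle. -/
theorem rectIntegral_kernel {Φ F : ℂ → ℂ} (hd : DifferentiableOn ℂ Φ strip)
    (hinj : InjOn Φ strip) (hF : Differentiable ℂ F) {a b c d : ℝ} {s₀ : ℂ}
    (hsub : ∀ s : ℂ, s.re ∈ Icc a b → s.im ∈ Icc c d → s ∈ strip)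
    (ha : a < s₀.re) (hb : s₀.re < b) (hc : c < s₀.im) (hd' : s₀.im < d) :
    rectIntegral (kernel Φ F (Φ s₀)) a b c d = 2 * Real.pi * Complex.I * F s₀ := by
  have hab : a ≤ b := (ha.trans hb).le
  have hcd : c ≤ d := (hc.trans hd').le
  have hs₀ : s₀ ∈ strip := hsub s₀ ⟨ha.le, hb.le⟩ ⟨hc.le, hd'.le⟩
  have hnhds := isOpen_strip.mem_nhds hs₀
  -- The divided difference of Φ has no zeros by injectivity, so N is holomorphic with N(s₀) =
  -- F(s₀). The kernel is N(s)/(s - s₀), that is, a holomorphic function plus F(s₀)/(s - s₀).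
  set N : ℂ → ℂ := fun s => F s * deriv Φ s / dslope Φ s₀ s with hN
  have hD : DifferentiableOn ℂ (dslope Φ s₀) strip := (Complex.differentiableOn_dslope hnhds).2 hd
  have hD0 : ∀ s ∈ strip, dslope Φ s₀ s ≠ 0 := by
    intro s hs
    rcases eq_or_ne s s₀ with rfl | hne
    · rw [dslope_same]
      exact deriv_ne_zero_of_injOn isOpen_strip hd hinj hs
    · rw [dslope_of_ne _ hne, slope_def_field]
      exact div_ne_zero (sub_ne_zero.2 fun h => hne (hinj hs hs₀ h)) (sub_ne_zero.2 hne)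
  have hNd : DifferentiableOn ℂ N strip :=
    (hF.differentiableOn.mul (hd.deriv isOpen_strip)).div hD hD0
  have hNs₀ : N s₀ = F s₀ := by
    have := deriv_ne_zero_of_injOn isOpen_strip hd hinj hs₀
    simp [hN, dslope_same, this]
  have hD2 : DifferentiableOn ℂ (dslope N s₀) strip :=
    (Complex.differentiableOn_dslope hnhds).2 hNd
  have hne : ∀ s : ℂ, (s.re = a ∨ s.re = b ∨ s.im = c ∨ s.im = d) → s ≠ s₀ := by
    rintro s h rfl
    rcases h with h | h | h | h <;> linarith
  rw [rectIntegral_congr (g := fun s => dslope N s₀ s + F s₀ * (s - s₀)⁻¹) hab hcd ?_,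
    rectIntegral_add hab hcd ?_ ?_, rectIntegral_const_mul, rectIntegral_inv_sub ha hb hc hd',
    rectIntegral_eq_zero hab hcd, zero_add, mul_comm]
  · intro s h1 h2
    exact hD2.differentiableAt (isOpen_strip.mem_nhds (hsub s h1 h2))
  · intro s h1 h2 _
    exact (hD2.differentiableAt (isOpen_strip.mem_nhds (hsub s h1 h2))).continuousAt
  · intro s _ _ h3
    exact continuousAt_const.mul
      (ContinuousAt.inv₀ (by fun_prop) (sub_ne_zero.2 (hne s h3)))
  · intro s h1 h2 h3
    have hs := hsub s h1 h2
    have h4 := sub_ne_zero.2 (hne s h3)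
    have h5 : Φ s - Φ s₀ ≠ 0 := sub_ne_zero.2 fun h => hne s h3 (hinj hs hs₀ h)
    rw [dslope_of_ne _ (hne s h3), slope_def_field, hNs₀]
    simp only [hN, kernel]
    rw [dslope_of_ne _ (hne s h3), slope_def_field]
    field_simp
    ring

/-! ### The model function and contour integrals over half strips -/

/-- The model function `exp (exp (ρ s))` on the strip. -/
noncomputable def expExp (ρ : ℝ) (s : ℂ) : ℂ := Complex.exp (Complex.exp (ρ * s))

theorem differentiable_expExp (ρ : ℝ) : Differentiable ℂ (expExp ρ) := by
  unfold expExp; fun_prop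

theorem norm_expExp (ρ : ℝ) (s : ℂ) :
    ‖expExp ρ s‖ = Real.exp (Real.exp (ρ * s.re) * Real.cos (ρ * s.im)) := by
  rw [expExp, Complex.norm_exp, Complex.exp_re]
  simp

/-- Since ρ < 2, ρ|y| stays below π, in the range where the cosine decreases. -/
theorem cos_le_of_abs_le {ρ θ y : ℝ} (hρ1 : 1 < ρ) (hρ2 : ρ < 2) (hθ : 0 ≤ θ) (h1 : θ ≤ |y|)
    (h2 : |y| < Real.pi / 2) : Real.cos (ρ * y) ≤ Real.cos (ρ * θ) := by
  rw [← Real.cos_abs (ρ * y), abs_mul, abs_of_pos (by linarith : 0 < ρ)]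
  refine Real.cos_le_cos_of_nonneg_of_le_pi (by positivity) ?_ (by gcongr)
  nlinarith [abs_nonneg y]

theorem cos_neg_of_lt {ρ θ : ℝ} (hρ1 : 1 < ρ) (hρ2 : ρ < 2) (h1 : Real.pi / 2 < ρ * θ)
    (h2 : θ < Real.pi / 2) : Real.cos (ρ * θ) < 0 := by
  have hθ : 0 < θ := by
    by_contra! h
    nlinarith [Real.pi_pos]
  exact Real.cos_neg_of_pi_div_two_lt_of_lt h1 (by nlinarith [Real.pi_pos])

/-- The boundary of the half strip `{Re s > x, |Im s| < θ}`. -/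
def halfStripBdry (x θ : ℝ) : Set ℂ :=
  {s | (s.re = x ∧ |s.im| ≤ θ) ∨ (x ≤ s.re ∧ |s.im| = θ)}

/-- The integral of the Cauchy kernel over the boundary of a half strip. -/
noncomputable def contourIntegral (Φ F : ℂ → ℂ) (x θ : ℝ) (z : ℂ) : ℂ :=
  (∫ t in Ioi x, kernel Φ F z (t + (-θ : ℝ) * Complex.I)) -
    (∫ t in Ioi x, kernel Φ F z (t + θ * Complex.I)) -
    Complex.I * ∫ y in Ioc (-θ) θ, kernel Φ F z (x + y * Complex.I)

section Contour

variable {Φ : ℂ → ℂ} {ρ x θ δ : ℝ}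

/-- Here cos(ρθ) = -c < 0, so |F| = exp(-c e^{ρt}) is dominated by exp(-cρt). The hypotheses use |θ|
so that both edges are covered. -/
theorem integrableOn_expExp (hρ1 : 1 < ρ) (hρ2 : ρ < 2) (h1 : Real.pi / 2 < ρ * |θ|)
    (h2 : |θ| < Real.pi / 2) :
    MeasureTheory.IntegrableOn (fun t : ℝ => expExp ρ (t + θ * Complex.I)) (Ioi x) := by
  have hc := cos_neg_of_lt hρ1 hρ2 h1 h2
  have hc' : Real.cos (ρ * θ) < 0 :=
    (cos_le_of_abs_le hρ1 hρ2 (abs_nonneg θ) le_rfl h2).trans_lt hc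
  set c := -Real.cos (ρ * θ) with hcdef
  have hcpos : 0 < c := by linarith
  have hi := integrableOn_exp_mul_Ioi (a := -(c * ρ)) (by nlinarith) x
  refine MeasureTheory.Integrable.mono' hi ?_ (Eventually.of_forall fun t => ?_)
  · have : Continuous fun t : ℝ => expExp ρ (t + θ * Complex.I) :=
      (differentiable_expExp ρ).continuous.comp (by fun_prop)
    exact this.aestronglyMeasurable
  · rw [norm_expExp]
    simp only [Complex.add_re, Complex.ofReal_re, Complex.mul_re, Complex.I_re, mul_zero,
      Complex.ofReal_im, Complex.I_im, mul_one, sub_self, add_zero, Complex.add_im, Complex.mul_im,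
      zero_add]
    have := Real.add_one_le_exp (ρ * t)
    exact Real.exp_le_exp.2 (by nlinarith)

variable (hd : DifferentiableOn ℂ Φ strip) (hinj : InjOn Φ strip) (hρ1 : 1 < ρ) (hρ2 : ρ < 2)
  (hθ : Real.pi / 2 < ρ * θ) (hδ : 0 < δ) (hθδ : θ + δ ≤ Real.pi / 2)

include hρ1 hθ in
theorem pos_of_lt_mul : 0 < θ := by
  by_contra! h
  nlinarith [Real.pi_pos]

include hd hinj hρ1 hρ2 hθ hδ hθδ

/-- The bound does not involve z, which is what makes the entire function bounded away from the
tract. -/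
theorem integrableOn_kernel_edges {z : ℂ}
    (hz : ∀ s ∈ halfStripBdry x θ, ∀ u ∈ Metric.ball s δ, Φ u ≠ z) :
    MeasureTheory.IntegrableOn
        (fun t : ℝ => kernel Φ (expExp ρ) z (t + (-θ : ℝ) * Complex.I)) (Ioi x) ∧
      MeasureTheory.IntegrableOn
        (fun t : ℝ => kernel Φ (expExp ρ) z (t + θ * Complex.I)) (Ioi x) ∧
      ‖contourIntegral Φ (expExp ρ) x θ z‖ ≤
        500 / δ * (∫ t in Ioi x, ‖expExp ρ (t + (-θ : ℝ) * Complex.I)‖) +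
        500 / δ * (∫ t in Ioi x, ‖expExp ρ (t + θ * Complex.I)‖) +
        500 / δ * (∫ y in Ioc (-θ) θ, ‖expExp ρ (x + y * Complex.I)‖) := by
  have hθ0 := pos_of_lt_mul hρ1 hθ
  have hFc : ContinuousOn (expExp ρ) strip := (differentiable_expExp ρ).continuous.continuousOn
  have e1 := integrableOn_kernel hd hinj hFc hδ
    (σ := fun t : ℝ => (t + (-θ : ℝ) * Complex.I : ℂ)) (by fun_prop)
    (measurableSet_Ioi (a := x)) (fun t _ => ball_subset_strip (θ := θ)
      (by simp [abs_of_pos hθ0]) hθδ)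
    (integrableOn_expExp hρ1 hρ2 (by rwa [abs_neg, abs_of_pos hθ0])
      (by rw [abs_neg, abs_of_pos hθ0]; linarith))
    (fun t ht => hz _ (Or.inr (by simpa [abs_of_pos hθ0] using (mem_Ioi.1 ht).le)))
  have e2 := integrableOn_kernel hd hinj hFc hδ
    (σ := fun t : ℝ => (t + θ * Complex.I : ℂ)) (by fun_prop)
    (measurableSet_Ioi (a := x)) (fun t _ => ball_subset_strip (θ := θ)
      (by simp [abs_of_pos hθ0]) hθδ)
    (integrableOn_expExp hρ1 hρ2 (by rwa [abs_of_pos hθ0])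
      (by rw [abs_of_pos hθ0]; linarith))
    (fun t ht => hz _ (Or.inr (by simpa [abs_of_pos hθ0] using (mem_Ioi.1 ht).le)))
  have e3 := integrableOn_kernel hd hinj hFc hδ
    (σ := fun y : ℝ => (x + y * Complex.I : ℂ)) (by fun_prop)
    (measurableSet_Ioc (a := -θ) (b := θ)) (fun y hy => ball_subset_strip (θ := θ)
      (by simpa using abs_le.2 ⟨hy.1.le, hy.2⟩) hθδ)
    (Continuous.integrableOn_Ioc
      ((differentiable_expExp ρ).continuous.comp (by fun_prop)))
    (fun y hy => hz _ (Or.inl (by simpa using abs_le.2 ⟨hy.1.le, hy.2⟩)))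
  refine ⟨e1.1, e2.1, ?_⟩
  unfold contourIntegral
  refine (norm_sub_le _ _).trans (add_le_add ((norm_sub_le _ _).trans (add_le_add e1.2 e2.2)) ?_)
  rw [norm_mul, Complex.norm_I, one_mul]
  exact e3.2

theorem differentiableOn_contourIntegral {A : Set ℂ} (hA : IsOpen A)
    (hz : ∀ s ∈ halfStripBdry x θ, ∀ u ∈ Metric.ball s δ, Φ u ∉ A) :
    DifferentiableOn ℂ (contourIntegral Φ (expExp ρ) x θ) A := by
  have hθ0 := pos_of_lt_mul hρ1 hθ
  have hFc : ContinuousOn (expExp ρ) strip := (differentiable_expExp ρ).continuous.continuousOn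
  have e1 := differentiableOn_integral_kernel hd hinj hFc hδ
    (σ := fun t : ℝ => (t + (-θ : ℝ) * Complex.I : ℂ)) (by fun_prop)
    (measurableSet_Ioi (a := x)) (fun t _ => ball_subset_strip (θ := θ)
      (by simp [abs_of_pos hθ0]) hθδ)
    (integrableOn_expExp hρ1 hρ2 (by rwa [abs_neg, abs_of_pos hθ0])
      (by rw [abs_neg, abs_of_pos hθ0]; linarith)) hA
    (fun t ht => hz _ (Or.inr (by simpa [abs_of_pos hθ0] using (mem_Ioi.1 ht).le)))
  have e2 := differentiableOn_integral_kernel hd hinj hFc hδ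
    (σ := fun t : ℝ => (t + θ * Complex.I : ℂ)) (by fun_prop)
    (measurableSet_Ioi (a := x)) (fun t _ => ball_subset_strip (θ := θ)
      (by simp [abs_of_pos hθ0]) hθδ)
    (integrableOn_expExp hρ1 hρ2 (by rwa [abs_of_pos hθ0])
      (by rw [abs_of_pos hθ0]; linarith)) hA
    (fun t ht => hz _ (Or.inr (by simpa [abs_of_pos hθ0] using (mem_Ioi.1 ht).le)))
  have e3 := differentiableOn_integral_kernel hd hinj hFc hδ
    (σ := fun y : ℝ => (x + y * Complex.I : ℂ)) (by fun_prop)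
    (measurableSet_Ioc (a := -θ) (b := θ)) (fun y hy => ball_subset_strip (θ := θ)
      (by simpa using abs_le.2 ⟨hy.1.le, hy.2⟩) hθδ)
    (Continuous.integrableOn_Ioc
      ((differentiable_expExp ρ).continuous.comp (by fun_prop))) hA
    (fun y hy => hz _ (Or.inl (by simpa using abs_le.2 ⟨hy.1.le, hy.2⟩)))
  exact (e1.sub e2).sub (e3.const_mul Complex.I)

/-- The far side of the rectangle is not negligible, because F is huge in the middle of the strip.
It is subtracted here and cancelled later between two contours. -/
theorem tendsto_rectIntegral {z : ℂ}
    (hz : ∀ s ∈ halfStripBdry x θ, ∀ u ∈ Metric.ball s δ, Φ u ≠ z) :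
    Tendsto (fun X : ℝ => rectIntegral (kernel Φ (expExp ρ) z) x X (-θ) θ -
      Complex.I * ∫ y in (-θ)..θ, kernel Φ (expExp ρ) z (X + y * Complex.I)) atTop
      (𝓝 (contourIntegral Φ (expExp ρ) x θ z)) := by
  obtain ⟨h1, h2, -⟩ := integrableOn_kernel_edges hd hinj hρ1 hρ2 hθ hδ hθδ hz
  have hθ0 := pos_of_lt_mul hρ1 hθ
  have t1 := MeasureTheory.intervalIntegral_tendsto_integral_Ioi x h1 tendsto_id
  have t2 := MeasureTheory.intervalIntegral_tendsto_integral_Ioi x h2 tendsto_id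
  refine ((t1.sub t2).sub_const (Complex.I * ∫ y in Ioc (-θ) θ,
    kernel Φ (expExp ρ) z (x + y * Complex.I))).congr fun X => ?_
  rw [rectIntegral, ← intervalIntegral.integral_of_le (by linarith)]
  simp only [id]
  ring

omit hθδ in
/-- The contribution of the far sides of two nested half strips cancels in the limit. -/
theorem tendsto_far_sides {θ' : ℝ} (hθθ' : θ ≤ θ') (hθ' : θ' + δ ≤ Real.pi / 2) {s₀ : ℂ}
    (hs₀ : s₀ ∈ strip) :
    Tendsto (fun X : ℝ => Complex.I * (∫ y in (-θ')..θ', kernel Φ (expExp ρ) (Φ s₀)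
        (X + y * Complex.I)) - Complex.I * ∫ y in (-θ)..θ, kernel Φ (expExp ρ) (Φ s₀)
        (X + y * Complex.I)) atTop (𝓝 0) := by
  have hθ0 := pos_of_lt_mul hρ1 hθ
  have hcpos := cos_neg_of_lt hρ1 hρ2 hθ (by linarith)
  set c := Real.cos (ρ * θ) with hc
  have hlim : Tendsto (fun X : ℝ => 500 / δ * Real.exp (Real.exp (ρ * X) * c) * (θ' - θ) * 2) atTop
      (𝓝 0) := by
    have h1 : Tendsto (fun X : ℝ => Real.exp (ρ * X) * c) atTop atBot :=
      (Real.tendsto_exp_atTop.comp (tendsto_id.const_mul_atTop (by linarith))).atTop_mul_const_of_neg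
        hcpos
    simpa using (((Real.tendsto_exp_atBot.comp h1).const_mul (500 / δ)).mul_const
      (θ' - θ)).mul_const 2
  refine squeeze_zero_norm' ?_ hlim
  filter_upwards [eventually_gt_atTop (s₀.re + δ)] with X hX
  -- Only the heights θ ≤ |y| ≤ θ' survive the subtraction, and there F is doubly exponentially
  -- small.
  have hbound : ∀ y : ℝ, θ ≤ |y| → |y| ≤ θ' →
      ‖kernel Φ (expExp ρ) (Φ s₀) (X + y * Complex.I)‖ ≤
        500 / δ * Real.exp (Real.exp (ρ * X) * c) := by
    intro y h1 h2
    have hb : Metric.ball (X + y * Complex.I : ℂ) δ ⊆ strip :=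
      ball_subset_strip (θ := θ') (by simpa using h2) hθ'
    refine (norm_kernel_le hd hinj hδ hb fun u hu h => ?_).trans ?_
    · have h3 := hinj (hb hu) hs₀ h
      rw [h3, Metric.mem_ball, dist_eq_norm] at hu
      have h4 := (Complex.abs_re_le_norm _).trans_lt hu
      have h5 := neg_abs_le (s₀ - (X + y * Complex.I)).re
      simp at h5 h4
      linarith
    · rw [norm_expExp]
      have h3 := cos_le_of_abs_le hρ1 hρ2 hθ0.le h1 (by linarith)
      simp only [Complex.add_re, Complex.ofReal_re, Complex.mul_re, Complex.I_re, mul_zero,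
        Complex.ofReal_im, Complex.I_im, mul_one, sub_self, add_zero, Complex.add_im,
        Complex.mul_im, zero_add]
      gcongr
  have hci : ∀ a b : ℝ, a ∈ Icc (-θ') θ' → b ∈ Icc (-θ') θ' → IntervalIntegrable
      (fun y : ℝ => kernel Φ (expExp ρ) (Φ s₀) (X + y * Complex.I)) MeasureTheory.volume a b := by
    intro a b ha hb
    refine ContinuousOn.intervalIntegrable fun y hy => ContinuousAt.continuousWithinAt ?_
    have hy' : y ∈ Icc (-θ') θ' := (uIcc_subset_Icc ha hb) hy
    have hst : (X + y * Complex.I : ℂ) ∈ strip :=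
      mem_strip_mk.2 (by linarith [abs_le.2 hy'])
    refine ContinuousAt.comp (f := fun y : ℝ => (X + y * Complex.I : ℂ))
      (kernel_differentiableAt hd (differentiable_expExp ρ) hst fun h => ?_).continuousAt
      (by fun_prop)
    have h3 := congrArg Complex.re (hinj hst hs₀ h)
    simp at h3
    linarith
  have hsplit : (∫ y in (-θ')..θ', kernel Φ (expExp ρ) (Φ s₀) (X + y * Complex.I)) =
      (∫ y in (-θ')..(-θ), kernel Φ (expExp ρ) (Φ s₀) (X + y * Complex.I)) +
      (∫ y in (-θ)..θ, kernel Φ (expExp ρ) (Φ s₀) (X + y * Complex.I)) +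
      (∫ y in θ..θ', kernel Φ (expExp ρ) (Φ s₀) (X + y * Complex.I)) := by
    rw [intervalIntegral.integral_add_adjacent_intervals
      (hci _ _ ⟨by linarith, by linarith⟩ ⟨by linarith, by linarith⟩)
      (hci _ _ ⟨by linarith, by linarith⟩ ⟨by linarith, by linarith⟩),
      intervalIntegral.integral_add_adjacent_intervals
      (hci _ _ ⟨by linarith, by linarith⟩ ⟨by linarith, by linarith⟩)
      (hci _ _ ⟨by linarith, by linarith⟩ ⟨by linarith, by linarith⟩)]
  have b1 : ‖∫ y in (-θ')..(-θ), kernel Φ (expExp ρ) (Φ s₀) (X + y * Complex.I)‖ ≤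
      500 / δ * Real.exp (Real.exp (ρ * X) * c) * |-θ - -θ'| :=
    intervalIntegral.norm_integral_le_of_norm_le_const fun y hy => by
      rw [uIoc_of_le (by linarith)] at hy
      have : |y| = -y := abs_of_nonpos (by linarith [hy.2])
      exact hbound y (by rw [this]; linarith [hy.2]) (by rw [this]; linarith [hy.1])
  have b2 : ‖∫ y in θ..θ', kernel Φ (expExp ρ) (Φ s₀) (X + y * Complex.I)‖ ≤
      500 / δ * Real.exp (Real.exp (ρ * X) * c) * |θ' - θ| :=
    intervalIntegral.norm_integral_le_of_norm_le_const fun y hy => by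
      rw [uIoc_of_le (by linarith)] at hy
      have : |y| = y := abs_of_nonneg (by linarith [hy.1])
      exact hbound y (by rw [this]; linarith [hy.1]) (by rw [this]; linarith [hy.2])
  rw [abs_of_nonneg (by linarith)] at b1 b2
  rw [hsplit, ← mul_sub, norm_mul, Complex.norm_I, one_mul]
  calc _ = ‖(∫ y in (-θ')..(-θ), kernel Φ (expExp ρ) (Φ s₀) (X + y * Complex.I)) +
        ∫ y in θ..θ', kernel Φ (expExp ρ) (Φ s₀) (X + y * Complex.I)‖ := by congr 1; ring
    _ ≤ _ := (norm_add_le _ _).trans (add_le_add b1 b2)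
    _ = _ := by ring

omit hθδ in
/-- Cauchy's formula for the difference of the contour integrals over two nested half strips. -/
theorem contourIntegral_sub {x' θ' : ℝ} (hθθ' : θ ≤ θ') (hθ' : θ' + δ ≤ Real.pi / 2) {s₀ : ℂ}
    (h₁ : x' < s₀.re) (h₂ : |s₀.im| < θ') (h₃ : s₀.re < x ∨ θ < |s₀.im|)
    (hz : ∀ s ∈ halfStripBdry x θ, ∀ u ∈ Metric.ball s δ, Φ u ≠ Φ s₀)
    (hz' : ∀ s ∈ halfStripBdry x' θ', ∀ u ∈ Metric.ball s δ, Φ u ≠ Φ s₀) :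
    contourIntegral Φ (expExp ρ) x' θ' (Φ s₀) - contourIntegral Φ (expExp ρ) x θ (Φ s₀) =
      2 * Real.pi * Complex.I * expExp ρ s₀ := by
  have hθ0 := pos_of_lt_mul hρ1 hθ
  have hs₀ : s₀ ∈ strip := mem_strip.2 (by linarith)
  have t1 := tendsto_rectIntegral hd hinj hρ1 hρ2 hθ hδ (by linarith) hz
  have t2 := tendsto_rectIntegral hd hinj hρ1 hρ2
    (hθ.trans_le (by gcongr : ρ * θ ≤ ρ * θ')) hδ hθ' hz'
  have t3 := tendsto_far_sides hd hinj hρ1 hρ2 hθ hδ hθθ' hθ' hs₀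
  have t4 := (t2.sub t1).add t3
  rw [add_zero] at t4
  refine tendsto_nhds_unique t4 (tendsto_const_nhds.congr' ?_)
  filter_upwards [eventually_gt_atTop (max x s₀.re)] with X hX
  have hXx := (le_max_left _ _).trans_lt hX
  have hXs := (le_max_right _ _).trans_lt hX
  -- The larger rectangle encloses s₀ and contributes the residue. The smaller one does not contain
  -- it and contributes nothing.
  have e1 : rectIntegral (kernel Φ (expExp ρ) (Φ s₀)) x' X (-θ') θ' =
      2 * Real.pi * Complex.I * expExp ρ s₀ :=
    rectIntegral_kernel hd hinj (differentiable_expExp ρ)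
      (fun s _ h => mem_strip.2 (by linarith [abs_le.2 h])) h₁ hXs (abs_lt.1 h₂).1 (abs_lt.1 h₂).2
  have e2 : rectIntegral (kernel Φ (expExp ρ) (Φ s₀)) x X (-θ) θ = 0 := by
    refine rectIntegral_eq_zero hXx.le (by linarith) fun s hs1 hs2 => ?_
    have hs : s ∈ strip := mem_strip.2 (by linarith [abs_le.2 hs2])
    refine kernel_differentiableAt hd (differentiable_expExp ρ) hs fun h => ?_
    have := hinj hs hs₀ h
    rw [this] at hs1 hs2
    rcases h₃ with h | h
    · linarith [hs1.1]
    · linarith [abs_le.2 hs2]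
  rw [e1, e2]
  ring

end Contour

/-- Near a given w only a compact rectangle matters, since Φ is larger than |w| + 1 beyond it. This
is the only use of Φ → ∞ in building the entire function. -/
theorem isClosed_image_halfStrip {Φ : ℂ → ℂ} (hc : ContinuousOn Φ strip)
    (hinf : ∀ θ < Real.pi / 2, ∀ M : ℝ, ∃ X, ∀ s : ℂ, X ≤ s.re → |s.im| ≤ θ → M < ‖Φ s‖)
    (x : ℝ) {θ : ℝ} (hθ : θ < Real.pi / 2) :
    IsClosed (Φ '' {s | x ≤ s.re ∧ |s.im| ≤ θ}) := by
  refine isClosed_of_closure_subset fun w hw => ?_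
  obtain ⟨X, hX⟩ := hinf θ hθ (‖w‖ + 1)
  set K : Set ℂ := Icc x X ×ℂ Icc (-θ) θ with hK
  have hKc : IsCompact K := isCompact_Icc.reProdIm isCompact_Icc
  have hKs : K ⊆ strip := fun s hs => mem_strip.2 (by linarith [abs_le.2 hs.2])
  have hKcl : IsClosed (Φ '' K) := (hKc.image_of_continuousOn (hc.mono hKs)).isClosed
  have hKT : Φ '' K ⊆ Φ '' {s | x ≤ s.re ∧ |s.im| ≤ θ} :=
    image_mono fun s hs => ⟨hs.1.1, abs_le.2 hs.2⟩
  refine hKT (hKcl.closure_subset_iff.2 subset_rfl ?_)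
  rw [mem_closure_iff_nhds] at hw ⊢
  intro t ht
  obtain ⟨_, ⟨h1, h2⟩, s, hs, rfl⟩ := hw (t ∩ Metric.ball w 1)
    (inter_mem ht (Metric.ball_mem_nhds w one_pos))
  refine ⟨Φ s, h1, s, ⟨⟨hs.1, ?_⟩, abs_le.1 hs.2⟩, rfl⟩
  by_contra! h
  have h3 := hX s h.le hs.2
  rw [Metric.mem_ball, dist_eq_norm] at h2
  have := norm_sub_norm_le (Φ s) w
  linarith

/-! ### Construction of the entire function -/

/-- An entire function approximating `exp (exp (ρ s))` in the coordinates given by a conformal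
map of the strip tending to `∞` at its right end. -/
theorem exists_entire_approx {Φ : ℂ → ℂ} {ρ : ℝ} (hd : DifferentiableOn ℂ Φ strip)
    (hinj : InjOn Φ strip) (hρ1 : 1 < ρ) (hρ2 : ρ < 2)
    (hinf : ∀ θ < Real.pi / 2, ∀ M : ℝ, ∃ X, ∀ s : ℂ, X ≤ s.re → |s.im| ≤ θ → M < ‖Φ s‖) :
    ∃ (g : ℂ → ℂ) (C : ℝ), Differentiable ℂ g ∧
      (∀ s ∈ strip, ‖g (Φ s) - expExp ρ s‖ ≤ C) ∧ ∀ z ∉ Φ '' strip, ‖g z‖ ≤ C := by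
  classical
  have hpi := Real.pi_pos
  obtain ⟨θ, hθl, hθr⟩ : ∃ θ, Real.pi / 2 / ρ < θ ∧ θ < Real.pi / 2 :=
    exists_between (div_lt_self (by positivity) hρ1)
  have hθ : Real.pi / 2 < ρ * θ := by
    rw [div_lt_iff₀ (by linarith)] at hθl; linarith
  -- Four layers of width δ: inner contour at height θ, T at θ + δ, Q at θ + 2δ, outer contour at θ
  -- + 3δ. Discs of radius δ about the inner contour lie in T, and those about the outer contour
  -- miss Q and stay in the strip.
  set δ := (Real.pi / 2 - θ) / 4 with hδdef
  have hδ : 0 < δ := by rw [hδdef]; linarith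
  have hθδ : θ + 4 * δ = Real.pi / 2 := by rw [hδdef]; ring
  have hθ' : Real.pi / 2 < ρ * (θ + 3 * δ) := by nlinarith
  have hθ0 : 0 < θ := pos_of_lt_mul hρ1 hθ
  set T : Set ℂ := {s | -δ ≤ s.re ∧ |s.im| ≤ θ + δ} with hT
  set Q : Set ℂ := {s | -(2 * δ) < s.re ∧ |s.im| < θ + 2 * δ} with hQ
  have hTs : T ⊆ strip := fun s hs => mem_strip.2 (by linarith [hs.2])
  have hQs : Q ⊆ strip := fun s hs => mem_strip.2 (by linarith [hs.2])
  have hTQ : T ⊆ Q := fun s hs => ⟨by linarith [hs.1], by linarith [hs.2]⟩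
  have hQo : IsOpen Q := (isOpen_lt continuous_const Complex.continuous_re).inter
    (isOpen_lt (continuous_abs.comp Complex.continuous_im) continuous_const)
  have hl : LeftInvOn (Function.invFunOn Φ strip) Φ strip := hinj.leftInvOn_invFunOn
  set Λ := Function.invFunOn Φ strip with hΛ
  obtain ⟨hopen, hΛd⟩ := differentiableOn_of_leftInvOn isOpen_strip hd hinj hl
  set A := (Φ '' T)ᶜ with hA
  set B := Φ '' Q with hB
  have hAo : IsOpen A :=
    (isClosed_image_halfStrip hd.continuousOn hinf (-δ) (by linarith)).isOpen_compl
  have hBo : IsOpen B := hopen Q hQs hQo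
  have hAB : ∀ z, z ∉ B → z ∈ A := fun z hz h => hz (image_mono hTQ h)
  have hav0 : ∀ s ∈ halfStripBdry 0 θ, ∀ u ∈ Metric.ball s δ, Φ u ∉ A := by
    intro s hs u hu h
    refine h (mem_image_of_mem Φ ?_)
    rw [Metric.mem_ball, dist_eq_norm] at hu
    have h1 := (Complex.abs_re_le_norm _).trans_lt hu
    have h2 := (Complex.abs_im_le_norm _).trans_lt hu
    have h3 := abs_sub_abs_le_abs_sub u.im s.im
    rw [Complex.sub_re, abs_lt] at h1
    rw [Complex.sub_im] at h2
    rcases hs with ⟨hs1, hs2⟩ | ⟨hs1, hs2⟩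
    · exact ⟨by linarith, by linarith⟩
    · exact ⟨by linarith, by linarith⟩
  have hav3 : ∀ s ∈ halfStripBdry (-(3 * δ)) (θ + 3 * δ), ∀ u ∈ Metric.ball s δ, Φ u ∉ B := by
    rintro s hs u hu ⟨q, hq, hqu⟩
    have hsim : |s.im| ≤ θ + 3 * δ := by
      rcases hs with hs | hs
      · exact hs.2
      · exact hs.2.le
    have hus : u ∈ strip := ball_subset_strip hsim (by linarith) hu
    obtain rfl := hinj (hQs hq) hus hqu
    rw [Metric.mem_ball, dist_eq_norm] at hu
    have h1 := (Complex.abs_re_le_norm _).trans_lt hu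
    have h2 := (Complex.abs_im_le_norm _).trans_lt hu
    have h3 := abs_sub_abs_le_abs_sub s.im q.im
    rw [Complex.sub_re, abs_lt] at h1
    rw [Complex.sub_im, abs_sub_comm] at h2
    rcases hs with ⟨hs1, hs2⟩ | ⟨hs1, hs2⟩
    · linarith [hq.1]
    · linarith [hq.2]
  set h₀ := contourIntegral Φ (expExp ρ) 0 θ with hh₀
  set h₃ := contourIntegral Φ (expExp ρ) (-(3 * δ)) (θ + 3 * δ) with hh₃
  have hd0 : DifferentiableOn ℂ h₀ A := differentiableOn_contourIntegral hd hinj hρ1 hρ2 hθ hδ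
    (by linarith) hAo hav0
  have hd3 : DifferentiableOn ℂ h₃ B := differentiableOn_contourIntegral hd hinj hρ1 hρ2 hθ' hδ
    (by linarith) hBo hav3
  obtain ⟨C₀, hC₀⟩ : ∃ C, ∀ z ∈ A, ‖h₀ z‖ ≤ C := ⟨_, fun z hz =>
    (integrableOn_kernel_edges hd hinj hρ1 hρ2 hθ hδ (by linarith)
      fun s hs u hu h => hav0 s hs u hu (h ▸ hz)).2.2⟩
  obtain ⟨C₃, hC₃⟩ : ∃ C, ∀ z ∈ B, ‖h₃ z‖ ≤ C := ⟨_, fun z hz =>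
    (integrableOn_kernel_edges hd hinj hρ1 hρ2 hθ' hδ (by linarith)
      fun s hs u hu h => hav3 s hs u hu (h ▸ hz)).2.2⟩
  set κ : ℂ := 2 * Real.pi * Complex.I with hκ
  have hκ0 : κ ≠ 0 := Complex.two_pi_I_ne_zero
  -- On the collar between the contours, the difference of the two Cauchy integrals is the residue
  -- 2πi F, so the two definitions of g agree there.
  have hjump : ∀ z ∈ A, z ∈ B → expExp ρ (Λ z) - h₃ z / κ = -(h₀ z / κ) := by
    rintro _ hzA ⟨s, hs, rfl⟩
    have hsT : s ∉ T := fun h => hzA (mem_image_of_mem Φ h)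
    have hsc : s.re < 0 ∨ θ < |s.im| := by
      by_contra! h
      exact hsT ⟨by linarith, by linarith⟩
    have h := contourIntegral_sub hd hinj hρ1 hρ2 hθ hδ (by linarith : θ ≤ θ + 3 * δ) (by linarith)
      (x' := -(3 * δ)) (by linarith [hs.1]) (by linarith [hs.2]) hsc
      (fun s' hs' u hu h => hav0 s' hs' u hu (h ▸ hzA))
      (fun s' hs' u hu h => hav3 s' hs' u hu (h ▸ ⟨s, hs, rfl⟩))
    rw [← hh₀, ← hh₃, ← hκ] at h
    rw [hl (hQs hs)]
    field_simp
    linear_combination -h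
  set g : ℂ → ℂ := fun z => if z ∈ B then expExp ρ (Λ z) - h₃ z / κ else -(h₀ z / κ) with hg
  have hgB : ∀ z ∈ B, g z = expExp ρ (Λ z) - h₃ z / κ := fun z hz => if_pos hz
  have hgA : ∀ z ∈ A, g z = -(h₀ z / κ) := by
    intro z hz
    by_cases h : z ∈ B
    · rw [hgB z h, hjump z hz h]
    · exact if_neg h
  have hgd : Differentiable ℂ g := by
    intro z
    by_cases hz : z ∈ B
    · have h1 : DifferentiableAt ℂ (fun z => expExp ρ (Λ z) - h₃ z / κ) z := by
        refine DifferentiableAt.sub ?_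
          ((hd3.differentiableAt (hBo.mem_nhds hz)).div_const κ)
        exact DifferentiableAt.comp (g := expExp ρ) z (differentiable_expExp ρ _)
          ((hΛd.mono (image_mono hQs)).differentiableAt (hBo.mem_nhds hz))
      refine h1.congr_of_eventuallyEq ?_
      filter_upwards [hBo.mem_nhds hz] with y hy using hgB y hy
    · have hzA := hAB z hz
      refine ((hd0.differentiableAt (hAo.mem_nhds hzA)).div_const κ).neg.congr_of_eventuallyEq ?_
      filter_upwards [hAo.mem_nhds hzA] with y hy using hgA y hy
  have hgAb : ∀ z ∈ A, ‖g z‖ ≤ C₀ / ‖κ‖ := by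
    intro z hz
    rw [hgA z hz, norm_neg, norm_div]
    gcongr
    exact hC₀ z hz
  -- The term e bounds F outside Q: either Re s ≤ 0, so |exp(ρs)| ≤ 1, or |Im s| ≥ θ, where the
  -- cosine is negative.
  refine ⟨g, max (C₀ / ‖κ‖ + Real.exp 1) (C₃ / ‖κ‖), hgd, fun s hs => ?_, fun z hz => ?_⟩
  · by_cases hsQ : s ∈ Q
    · refine le_trans ?_ (le_max_right _ _)
      have hzB : Φ s ∈ B := mem_image_of_mem Φ hsQ
      rw [hgB _ hzB, hl hs, sub_sub_cancel_left, norm_neg, norm_div]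
      gcongr
      exact hC₃ _ hzB
    · refine le_trans ?_ (le_max_left _ _)
      have hzB : Φ s ∉ B := by
        rintro ⟨q, hq, hqs⟩
        exact hsQ (hinj (hQs hq) hs hqs ▸ hq)
      refine (norm_sub_le _ _).trans (add_le_add (hgAb _ (hAB _ hzB)) ?_)
      rw [norm_expExp, Real.exp_le_exp]
      by_cases hre : s.re ≤ 0
      · calc Real.exp (ρ * s.re) * Real.cos (ρ * s.im) ≤ Real.exp (ρ * s.re) * 1 := by
              gcongr; exact Real.cos_le_one _
          _ ≤ 1 := by
              rw [mul_one, Real.exp_le_one_iff]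
              nlinarith
      · have him : θ ≤ |s.im| := by
          by_contra! h
          exact hsQ ⟨by linarith, by linarith⟩
        have h1 := (cos_le_of_abs_le hρ1 hρ2 hθ0.le him hs).trans_lt
          (cos_neg_of_lt hρ1 hρ2 hθ hθr)
        nlinarith [Real.exp_pos (ρ * s.re)]
  · refine (hgAb z (hAB z fun h => hz (image_mono hQs h))).trans
      (le_trans ?_ (le_max_left _ _))
    linarith [Real.exp_pos 1]

/-! ### Consequences of a logarithm on the tract -/

section Logarithm

variable {g p q : ℂ → ℂ} {K : ℝ}

/-- Data of a logarithm of `g` over the exterior of a disc: a homeomorphism `q` with inverse `p`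
from `{|g| > K}` onto a half plane, such that `g = exp ∘ q`. -/
structure IsExpTract (g p q : ℂ → ℂ) (K : ℝ) : Prop where
  pos : 0 < K
  continuousOn_q : ContinuousOn q {z | K < ‖g z‖}
  continuousOn_p : ContinuousOn p {t | Real.log K < t.re}
  exp_q : ∀ z, K < ‖g z‖ → Complex.exp (q z) = g z
  g_p : ∀ t : ℂ, Real.log K < t.re → g (p t) = Complex.exp t
  p_q : ∀ z, K < ‖g z‖ → p (q z) = z
  q_p : ∀ t : ℂ, Real.log K < t.re → q (p t) = t

theorem log_lt_re_iff (hK : 0 < K) (t : ℂ) : Real.log K < t.re ↔ K < ‖Complex.exp t‖ := by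
  rw [Complex.norm_exp, Real.log_lt_iff_lt_exp hK]

namespace IsExpTract

theorem re_q (h : IsExpTract g p q K) {z : ℂ} (hz : K < ‖g z‖) : Real.log K < (q z).re := by
  rw [log_lt_re_iff h.pos, h.exp_q z hz]; exact hz

theorem norm_g_p (h : IsExpTract g p q K) {t : ℂ} (ht : Real.log K < t.re) : K < ‖g (p t)‖ := by
  rw [h.g_p t ht]; exact (log_lt_re_iff h.pos t).1 ht

theorem norm_exp_q (h : IsExpTract g p q K) {z : ℂ} (hz : K < ‖g z‖) :
    K < ‖Complex.exp (q z)‖ := (log_lt_re_iff h.pos _).1 (h.re_q hz)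

theorem norm_g_p' (h : IsExpTract g p q K) {t : ℂ} (ht : K < ‖Complex.exp t‖) : K < ‖g (p t)‖ :=
  h.norm_g_p ((log_lt_re_iff h.pos _).2 ht)

/-- The homeomorphism from the tract onto the half plane. -/
noncomputable def homeomorph (h : IsExpTract g p q K) :
    (g ⁻¹' {w : ℂ | K < ‖w‖}) ≃ₜ (Complex.exp ⁻¹' {w : ℂ | K < ‖w‖}) where
  toFun z := ⟨q z, h.norm_exp_q z.2⟩
  invFun t := ⟨p t, h.norm_g_p' t.2⟩
  left_inv z := Subtype.ext (h.p_q z z.2)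
  right_inv t := Subtype.ext (h.q_p t ((log_lt_re_iff h.pos _).2 t.2))
  continuous_toFun := (continuousOn_iff_continuous_domRestrict.1 h.continuousOn_q).subtype_mk _
  continuous_invFun := by
    have h1 : ContinuousOn p (Complex.exp ⁻¹' {w : ℂ | K < ‖w‖}) :=
      h.continuousOn_p.mono fun t ht => (log_lt_re_iff h.pos _).2 ht
    exact (continuousOn_iff_continuous_domRestrict.1 h1).subtype_mk _

theorem simplyConnectedSpace (h : IsExpTract g p q K) :
    SimplyConnectedSpace (g ⁻¹' {w : ℂ | K < ‖w‖}) := by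
  have h1 : (Complex.exp ⁻¹' {w : ℂ | K < ‖w‖}) = {t : ℂ | Real.log K < t.re} := by
    ext t; exact (log_lt_re_iff h.pos t).symm
  have h2 : ContractibleSpace (Complex.exp ⁻¹' {w : ℂ | K < ‖w‖}) := by
    rw [h1]
    exact (convex_halfSpace_re_gt _).contractibleSpace ⟨((Real.log K + 1 : ℝ) : ℂ), by simp⟩
  have h3 : ContractibleSpace (g ⁻¹' {w : ℂ | K < ‖w‖}) := h.homeomorph.contractibleSpace
  infer_instance

/-- On the tract g is exp∘q with q a homeomorphism, and exp is a covering over the punctured plane.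
-/
theorem isUniversalCovering (h : IsExpTract g p q K) :
    IsUniversalCovering ({w : ℂ | K < ‖w‖}.restrictPreimage g) := by
  have hcomp : {w : ℂ | K < ‖w‖}.restrictPreimage g =
      {w : ℂ | K < ‖w‖}.restrictPreimage Complex.exp ∘ h.homeomorph := by
    ext z
    exact (h.exp_q z z.2).symm
  have hcov : IsCoveringMap ({w : ℂ | K < ‖w‖}.restrictPreimage Complex.exp) := by
    refine (Complex.isCoveringMapOn_exp.mono fun w hw => ?_).isCoveringMap_restrictPreimage
    rintro rfl
    have hw' : K < ‖(0 : ℂ)‖ := hw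
    rw [norm_zero] at hw'
    linarith [h.pos]
  refine ⟨?_, ?_, h.simplyConnectedSpace⟩
  · rw [hcomp]
    exact fun x => ((hcov x).comp_homeomorph h.homeomorph).to_isEvenlyCovered_preimage
  · rw [hcomp]
    refine Function.Surjective.comp ?_ h.homeomorph.surjective
    rintro ⟨w, hw⟩
    have hw0 : w ≠ 0 := by
      rintro rfl
      have hw' : K < ‖(0 : ℂ)‖ := hw
      rw [norm_zero] at hw'
      linarith [h.pos]
    exact ⟨⟨Complex.log w, by rw [mem_preimage, Complex.exp_log hw0]; exact hw⟩,
      Subtype.ext (Complex.exp_log hw0)⟩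

/-- Over a disc in `{|w| > K}` the components of the preimage are mapped bijectively. -/
theorem singularValues_subset (h : IsExpTract g p q K) : singularValues g ⊆ Metric.closedBall 0 K := by
  intro a ha
  by_contra hcon
  have haK : K < ‖a‖ := by simpa using hcon
  have ha0 : a ≠ 0 := norm_pos_iff.1 (h.pos.trans haK)
  set r := ‖a‖ - K with hr
  have hr0 : 0 < r := sub_pos.2 haK
  have hball : ∀ w ∈ Metric.ball a r, K < ‖w‖ := by
    intro w hw
    rw [Metric.mem_ball, dist_eq_norm, norm_sub_rev] at hw
    have := norm_sub_norm_le a w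
    linarith
  obtain ⟨z, hz, hzbij⟩ := ha (Metric.ball a r) Metric.isOpen_ball (Metric.mem_ball_self hr0)
  refine hzbij ?_
  set U := Metric.ball a r with hU
  set D := connectedComponentIn (g ⁻¹' U) z with hD
  have hDU : D ⊆ g ⁻¹' U := connectedComponentIn_subset _ _
  have hslit : ∀ w ∈ U, w / a ∈ Complex.slitPlane := by
    intro w hw
    have h1 : w / a = 1 + (w - a) / a := by field_simp; ring
    rw [h1]
    refine Complex.mem_slitPlane_of_norm_lt_one ?_
    rw [norm_div, div_lt_one (norm_pos_iff.2 ha0), ← dist_eq_norm]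
    exact (Metric.mem_ball.1 hw).trans_le (by rw [hr]; linarith [h.pos])
  set lg : ℂ → ℂ := fun w => Complex.log (w / a) + Complex.log a with hlg
  have hlgc : ContinuousOn lg U :=
    (ContinuousOn.clog (by fun_prop) hslit).add continuousOn_const
  have hlge : ∀ w ∈ U, Complex.exp (lg w) = w := by
    intro w hw
    rw [hlg, Complex.exp_add, Complex.exp_log (Complex.slitPlane_ne_zero (hslit w hw)),
      Complex.exp_log ha0]
    field_simp
  -- The disc misses 0 and so carries a branch of the logarithm. The integer n selects the sheet for
  -- which p∘log is a section of g through z; its image gives surjectivity on the component.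
  obtain ⟨n, hn⟩ : ∃ n : ℤ, q z = lg (g z) + n * (2 * Real.pi * Complex.I) :=
    Complex.exp_eq_exp_iff_exists_int.1 (by rw [h.exp_q z (hball _ hz), hlge _ hz])
  have hexp : ∀ w ∈ U, Complex.exp (lg w + n * (2 * Real.pi * Complex.I)) = w := fun w hw => by
    rw [Complex.exp_add, Complex.exp_int_mul_two_pi_mul_I, mul_one, hlge w hw]
  have hre : ∀ w ∈ U, Real.log K < (lg w + n * (2 * Real.pi * Complex.I)).re := fun w hw => by
    rw [log_lt_re_iff h.pos, hexp w hw]; exact hball w hw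
  set σ : ℂ → ℂ := fun w => p (lg w + n * (2 * Real.pi * Complex.I)) with hσ
  have hσc : ContinuousOn σ U := h.continuousOn_p.comp (hlgc.add continuousOn_const) hre
  have hgσ : ∀ w ∈ U, g (σ w) = w := fun w hw => by
    rw [hσ, h.g_p _ (hre w hw), hexp w hw]
  have hσz : σ (g z) = z := by
    rw [hσ]; simp only; rw [← hn, h.p_q z (hball _ hz)]
  refine ⟨fun y hy => hDU hy, ?_, ?_⟩
  · have hpre : IsPreconnected D := isPreconnected_connectedComponentIn
    have hgD : ∀ y ∈ D, K < ‖g y‖ := fun y hy => hball _ (hDU hy)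
    have hqD : ContinuousOn q D := h.continuousOn_q.mono hgD
    have hgc : ContinuousOn g D := (Complex.continuous_exp.comp_continuousOn hqD).congr
      fun y hy => (h.exp_q y (hgD y hy)).symm
    -- On a connected component the sheet number is constant, so the value of g determines q and
    -- hence the point.
    obtain ⟨m, hm⟩ := exists_eq_add_int_of_exp_eq hpre (L₁ := q) (L₂ := fun y => lg (g y))
      hqD (hlgc.comp hgc fun y hy => hDU hy) fun y hy => by
        rw [h.exp_q y (hgD y hy), hlge _ (hDU hy)]
    intro x hx y hy hxy
    rw [← h.p_q x (hgD x hx), ← h.p_q y (hgD y hy), hm x hx, hm y hy, hxy]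
  · intro w hw
    refine ⟨σ w, ?_, hgσ w hw⟩
    have hpre : IsPreconnected (σ '' U) := (convex_ball a r).isPreconnected.image _ hσc
    refine hpre.subset_connectedComponentIn (x := z) ⟨g z, hz, hσz⟩ ?_ (mem_image_of_mem σ hw)
    rintro _ ⟨v, hv, rfl⟩
    rw [mem_preimage, hgσ v hv]; exact hv

/-- The value exp(t) is taken at each of the points p(t + 2πin), so a polynomial would be constant
with that value. Two values of different modulus give a contradiction. -/
theorem not_polynomial (h : IsExpTract g p q K) : ¬ ∃ P : Polynomial ℂ, ∀ z, g z = P.eval z := by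
  rintro ⟨P, hP⟩
  set a : ℂ := ((Real.log K + 1 : ℝ) : ℂ) with ha
  have hre : ∀ (v : ℂ) (n : ℕ), 0 ≤ v.re →
      Real.log K < (a + v + n * (2 * Real.pi * Complex.I)).re := by
    intro v n hv
    simp [ha]
    linarith
  have hinf : ∀ v : ℂ, 0 ≤ v.re → P = Polynomial.C (Complex.exp (a + v)) := by
    intro v hv
    by_contra hne
    have hne' : P - Polynomial.C (Complex.exp (a + v)) ≠ 0 := sub_ne_zero.2 hne
    refine Set.infinite_of_injective_forall_mem (s := {z | (P - Polynomial.C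
      (Complex.exp (a + v))).IsRoot z})
      (f := fun n : ℕ => p (a + v + n * (2 * Real.pi * Complex.I))) ?_ ?_
      (Polynomial.finite_setOfPred_isRoot hne')
    · intro m n hmn
      have h1 := congrArg q hmn
      simp only at h1
      rw [h.q_p _ (hre v m hv), h.q_p _ (hre v n hv)] at h1
      have h2 := mul_right_cancel₀ Complex.two_pi_I_ne_zero (add_left_cancel h1)
      exact_mod_cast h2
    · intro n
      simp only [Set.mem_ofPred_eq, Polynomial.IsRoot.def, Polynomial.eval_sub, Polynomial.eval_C,
        sub_eq_zero]
      rw [← hP, h.g_p _ (hre v n hv), Complex.exp_add]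
      have := Complex.exp_int_mul_two_pi_mul_I n
      push_cast at this
      rw [this, mul_one]
  have h1 := Polynomial.C_injective ((hinf 0 (by simp)).symm.trans (hinf 1 (by simp)))
  have h2 := congrArg (‖·‖) h1
  simp only [Complex.norm_exp, Real.exp_eq_exp] at h2
  simp at h2

end IsExpTract

end Logarithm

/-! ### Small holomorphic perturbations of the identity -/

section NearIdentity

variable {η : ℂ → ℂ} {a : ℝ} (hη : DifferentiableOn ℂ η {τ | a < τ.re})
  (hb : ∀ τ : ℂ, a < τ.re → ‖η τ‖ ≤ 1 / 2)

theorem isOpen_halfPlane (a : ℝ) : IsOpen {τ : ℂ | a < τ.re} :=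
  isOpen_lt continuous_const Complex.continuous_re

include hη hb

/-- Cauchy's estimate on unit discs gives |η'| ≤ 1/2, at the cost of moving the half plane by 1. -/
theorem norm_sub_le_of_near_id {τ τ' : ℂ} (hτ : a + 1 < τ.re) (hτ' : a + 1 < τ'.re) :
    ‖η τ - η τ'‖ ≤ 1 / 2 * ‖τ - τ'‖ := by
  refine Convex.norm_image_sub_le_of_norm_deriv_le (𝕜 := ℂ) (s := {τ : ℂ | a + 1 < τ.re})
    (fun x hx => ?_) (fun x hx => ?_) (convex_halfSpace_re_gt _) hτ' hτ
  · have hx' : a + 1 < x.re := hx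
    exact hη.differentiableAt ((isOpen_halfPlane a).mem_nhds (by
      simp only [mem_ofPred_eq]; linarith))
  · have hx' : a + 1 < x.re := hx
    have hsub : Metric.closedBall x 1 ⊆ {τ : ℂ | a < τ.re} := by
      intro y hy
      rw [Metric.mem_closedBall, dist_eq_norm] at hy
      have h1 := (Complex.abs_re_le_norm (y - x)).trans hy
      rw [Complex.sub_re, abs_le] at h1
      simp only [mem_ofPred_eq]
      linarith
    have h := Complex.norm_deriv_le_of_forall_mem_sphere_norm_le (c := x) one_pos
      (hη.diffContOnCl_ball hsub)
      fun y hy => hb y (hsub (Metric.sphere_subset_closedBall hy))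
    simpa using h

theorem norm_sub_le_two_mul {τ τ' : ℂ} (hτ : a + 1 < τ.re) (hτ' : a + 1 < τ'.re) :
    ‖τ - τ'‖ ≤ 2 * ‖(τ + η τ) - (τ' + η τ')‖ := by
  have h1 := norm_sub_le_of_near_id hη hb hτ hτ'
  have h2 : τ - τ' = ((τ + η τ) - (τ' + η τ')) - (η τ - η τ') := by ring
  have h3 := norm_sub_le ((τ + η τ) - (τ' + η τ')) (η τ - η τ')
  rw [← h2] at h3
  linarith

/-- The map τ ↦ t - η(τ) contracts the closed disc of radius 1/2 about t, and the margin a + 2 keeps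
this disc where the Lipschitz bound holds. -/
theorem exists_add_eq {t : ℂ} (ht : a + 2 < t.re) : ∃ τ : ℂ, a + 1 < τ.re ∧ τ + η τ = t := by
  have hre : ∀ y ∈ Metric.closedBall t (1 / 2), a + 1 < y.re := by
    intro y hy
    rw [Metric.mem_closedBall, dist_eq_norm] at hy
    have h1 := (Complex.abs_re_le_norm (y - t)).trans hy
    rw [Complex.sub_re, abs_le] at h1
    linarith
  have hmaps : MapsTo (fun τ => t - η τ) (Metric.closedBall t (1 / 2))
      (Metric.closedBall t (1 / 2)) := by
    intro y hy
    rw [Metric.mem_closedBall, dist_eq_norm, sub_sub_cancel_left, norm_neg]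
    exact hb y (by linarith [hre y hy])
  have hcontr : ContractingWith (1 / 2) (hmaps.restrict _ _ _) := by
    refine ⟨by norm_num, LipschitzWith.of_dist_le_mul fun x y => ?_⟩
    rw [Subtype.dist_eq, Subtype.dist_eq, dist_eq_norm, dist_eq_norm]
    simp only [MapsTo.val_restrict_apply]
    have h := norm_sub_le_of_near_id hη hb (hre x x.2) (hre y y.2)
    rw [sub_sub_sub_cancel_left, norm_sub_rev]
    simpa using h
  obtain ⟨τ, hτ, hfix, -⟩ := hcontr.exists_fixedPoint' Metric.isClosed_closedBall.isComplete hmaps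
    (Metric.mem_closedBall_self (by norm_num)) (edist_ne_top t _)
  refine ⟨τ, hre τ hτ, ?_⟩
  have h : t - η τ = τ := hfix
  linear_combination -h

end NearIdentity

/-! ### The logarithmic tract of the approximating function -/

/-- An entire function that is close to `exp (exp (ρ s))` in the coordinates of the strip and
bounded elsewhere has a logarithmic tract. -/
theorem exists_isExpTract {Φ g : ℂ → ℂ} {ρ C : ℝ} (hd : DifferentiableOn ℂ Φ strip)
    (hinj : InjOn Φ strip) (hρ1 : 1 < ρ) (hρ2 : ρ < 2) (hg : Differentiable ℂ g)
    (hgC : ∀ s ∈ strip, ‖g (Φ s) - expExp ρ s‖ ≤ C) (hgC' : ∀ z ∉ Φ '' strip, ‖g z‖ ≤ C) :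
    ∃ (K : ℝ) (p q : ℂ → ℂ), IsExpTract g p q K ∧ {z | K < ‖g z‖} ⊆ Φ '' strip := by
  classical
  wlog hC : 1 ≤ C generalizing C
  · exact this (C := 1) (fun s hs => (hgC s hs).trans (le_of_not_ge hC))
      (fun z hz => (hgC' z hz).trans (le_of_not_ge hC)) le_rfl
  have hρ0 : (ρ : ℂ) ≠ 0 := by
    have : ρ ≠ 0 := by linarith
    exact_mod_cast this
  -- For Re τ > a one has |e^τ| > 4C, so g/e^τ is within 1/4 of 1 and its logarithm η is at most
  -- 3/8.
  set a := Real.log (4 * C) with ha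
  have hea : Real.exp a = 4 * C := Real.exp_log (by linarith)
  have ha0 : 0 < a := Real.log_pos (by linarith)
  have hl : LeftInvOn (Function.invFunOn Φ strip) Φ strip := hinj.leftInvOn_invFunOn
  set Λ := Function.invFunOn Φ strip with hΛ
  obtain ⟨-, hΛd⟩ := differentiableOn_of_leftInvOn isOpen_strip hd hinj hl
  -- The inverse of τ = e^{ρs}. The principal logarithm recovers every s in the strip because ρ < 2
  -- gives |Im ρs| < π.
  set σ : ℂ → ℂ := fun τ => Φ (Complex.log τ / ρ) with hσ
  have hmem : ∀ τ : ℂ, 0 < τ.re → Complex.log τ / ρ ∈ strip := by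
    intro τ hτ
    rw [mem_strip, Complex.div_ofReal_im, Complex.log_im, abs_div, abs_of_pos (by linarith : 0 < ρ)]
    refine (div_le_self (abs_nonneg _) hρ1.le).trans_lt ?_
    exact Complex.abs_arg_lt_pi_div_two_iff.2 (Or.inl hτ)
  have hρlog : ∀ τ : ℂ, 0 < τ.re → Complex.exp (ρ * (Complex.log τ / ρ)) = τ := by
    intro τ hτ
    rw [mul_div_cancel₀ _ hρ0, Complex.exp_log]
    rintro rfl
    simp at hτ
  have hσexp : ∀ s ∈ strip, σ (Complex.exp (ρ * s)) = Φ s := by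
    intro s hs
    have h1 : |(ρ * s : ℂ).im| < Real.pi := by
      rw [Complex.im_ofReal_mul, abs_mul, abs_of_pos (by linarith : 0 < ρ)]
      have := mem_strip.1 hs
      nlinarith [abs_nonneg s.im]
    rw [hσ]
    simp only
    rw [Complex.log_exp (abs_lt.1 h1).1 (abs_lt.1 h1).2.le, mul_div_cancel_left₀ _ hρ0]
  have hσd : DifferentiableOn ℂ σ {τ | 0 < τ.re} := by
    refine hd.comp (fun τ hτ => ?_) hmem
    exact ((Complex.differentiableAt_log (Or.inl hτ)).div_const _).differentiableWithinAt
  have hclose : ∀ τ : ℂ, a < τ.re → ‖g (σ τ) * Complex.exp (-τ) - 1‖ ≤ 1 / 4 := by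
    intro τ hτ
    have hτ0 : 0 < τ.re := ha0.trans hτ
    have h1 := hgC _ (hmem τ hτ0)
    rw [expExp, hρlog τ hτ0] at h1
    have h2 : g (σ τ) * Complex.exp (-τ) - 1 = (g (σ τ) - Complex.exp τ) * Complex.exp (-τ) := by
      rw [sub_mul, ← Complex.exp_add, add_neg_cancel, Complex.exp_zero]
    rw [h2, norm_mul, Complex.norm_exp, Complex.neg_re, Real.exp_neg, ← div_eq_mul_inv,
      div_le_iff₀ (Real.exp_pos _)]
    have h3 := Real.exp_lt_exp.2 hτ
    rw [hea] at h3
    exact h1.trans (by linarith)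
  set η : ℂ → ℂ := fun τ => Complex.log (g (σ τ) * Complex.exp (-τ)) with hη
  have hslit : ∀ τ : ℂ, a < τ.re → g (σ τ) * Complex.exp (-τ) ∈ Complex.slitPlane := by
    intro τ hτ
    have h := Complex.mem_slitPlane_of_norm_lt_one ((hclose τ hτ).trans_lt (by norm_num))
    simpa using h
  have hsub : {τ : ℂ | a < τ.re} ⊆ {τ | 0 < τ.re} := fun τ hτ => ha0.trans hτ
  have hηd : DifferentiableOn ℂ η {τ | a < τ.re} := by
    refine DifferentiableOn.clog ?_ hslit
    exact (hg.comp_differentiableOn (hσd.mono hsub)).mul (by fun_prop)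
  have hηb : ∀ τ : ℂ, a < τ.re → ‖η τ‖ ≤ 1 / 2 := by
    intro τ hτ
    have h1 := hclose τ hτ
    have h2 := Complex.norm_log_one_add_half_le_self
      (z := g (σ τ) * Complex.exp (-τ) - 1) (by linarith)
    rw [add_sub_cancel] at h2
    rw [hη]
    simp only
    linarith
  have hexpT : ∀ τ : ℂ, a < τ.re → Complex.exp (τ + η τ) = g (σ τ) := by
    intro τ hτ
    rw [Complex.exp_add, hη]
    simp only
    rw [Complex.exp_log (Complex.slitPlane_ne_zero (hslit τ hτ)), mul_comm, mul_assoc,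
      ← Complex.exp_add, neg_add_cancel, Complex.exp_zero, mul_one]
  have hex : ∀ t : ℂ, ∃ τ : ℂ, a + 2 < t.re → a + 1 < τ.re ∧ τ + η τ = t := by
    intro t
    by_cases ht : a + 2 < t.re
    · obtain ⟨τ, hτ⟩ := exists_add_eq hηd hηb ht
      exact ⟨τ, fun _ => hτ⟩
    · exact ⟨0, fun h => absurd h ht⟩
  choose S hS using hex
  -- Two demands fix K: τ + η(τ) takes every value with real part above a + 2, and K ≥ C + e^{a+1}
  -- ensures that |g| > K forces Re τ > a + 1, where τ + η(τ) is injective.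
  set K := Real.exp (a + 2) with hK
  have hlogK : Real.log K = a + 2 := Real.log_exp _
  have hKC : C + Real.exp (a + 1) ≤ K := by
    rw [hK, Real.exp_add, Real.exp_add, hea]
    have h1 := Real.exp_one_gt_d9
    have h2 : Real.exp 2 = Real.exp 1 * Real.exp 1 := by rw [← Real.exp_add]; norm_num
    rw [h2]
    nlinarith [mul_pos (by linarith : 0 < C) (Real.exp_pos 1)]
  have hW : ∀ z, K < ‖g z‖ → ∃ s ∈ strip, Φ s = z ∧ a + 1 < (Complex.exp (ρ * s)).re := by
    intro z hz
    have hzV : z ∈ Φ '' strip := by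
      by_contra h
      linarith [hgC' z h, Real.exp_pos (a + 1)]
    obtain ⟨s, hs, rfl⟩ := hzV
    refine ⟨s, hs, rfl, ?_⟩
    have h1 := hgC s hs
    have h2 := norm_sub_norm_le (g (Φ s)) (expExp ρ s)
    have h3 : Real.exp (a + 1) < ‖expExp ρ s‖ := by linarith
    rw [expExp, Complex.norm_exp] at h3
    exact Real.exp_lt_exp.1 h3
  set q : ℂ → ℂ := fun z => Complex.exp (ρ * Λ z) + η (Complex.exp (ρ * Λ z)) with hq
  have hexpq : ∀ z, K < ‖g z‖ → Complex.exp (q z) = g z := by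
    intro z hz
    obtain ⟨s, hs, rfl, hre⟩ := hW z hz
    rw [hq]
    simp only
    rw [hl hs, hexpT _ (by linarith), hσexp s hs]
  refine ⟨K, fun t => σ (S t), q, ⟨Real.exp_pos _, ?_, ?_, hexpq, ?_, ?_, ?_⟩, ?_⟩
  · have h1 : ContinuousOn (fun z => Complex.exp (ρ * Λ z)) {z | K < ‖g z‖} := by
      refine Complex.continuous_exp.comp_continuousOn (continuousOn_const.mul
        (hΛd.continuousOn.mono fun z hz => ?_))
      obtain ⟨s, hs, hsz, -⟩ := hW z hz
      exact ⟨s, hs, hsz⟩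
    refine h1.add (hηd.continuousOn.comp h1 fun z hz => ?_)
    obtain ⟨s, hs, rfl, hre⟩ := hW z hz
    simp only [mem_ofPred_eq]
    rw [hl hs]
    linarith
  · rw [hlogK]
    refine hσd.continuousOn.comp (LipschitzOnWith.continuousOn (K := 2)
      (LipschitzOnWith.of_dist_le_mul fun t ht t' ht' => ?_)) fun t ht => ?_
    · obtain ⟨h1, h2⟩ := hS t ht
      obtain ⟨h1', h2'⟩ := hS t' ht'
      have h := norm_sub_le_two_mul hηd hηb h1 h1'
      rw [h2, h2'] at h
      rw [dist_eq_norm, dist_eq_norm]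
      simpa using h
    · have := (hS t ht).1
      simp only [mem_ofPred_eq]
      linarith
  · intro t ht
    rw [hlogK] at ht
    obtain ⟨h1, h2⟩ := hS t ht
    rw [← hexpT _ (by linarith), h2]
  · intro z hz
    have h0 : a + 2 < (q z).re := by
      rw [← hlogK, log_lt_re_iff (Real.exp_pos _), hexpq z hz]
      exact hz
    obtain ⟨h1, h2⟩ := hS (q z) h0
    obtain ⟨s, hs, rfl, hre⟩ := hW z hz
    have h3 : S (q (Φ s)) = Complex.exp (ρ * s) := by
      have h4 := norm_sub_le_two_mul hηd hηb h1 hre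
      have h5 : q (Φ s) = Complex.exp (ρ * s) + η (Complex.exp (ρ * s)) := by
        rw [hq]; simp only; rw [hl hs]
      rw [h2, h5, sub_self, norm_zero, mul_zero, ← h5] at h4
      exact sub_eq_zero.1 (norm_le_zero_iff.1 h4)
    rw [h3, hσexp s hs]
  · intro t ht
    rw [hlogK] at ht
    obtain ⟨h1, h2⟩ := hS t ht
    have h0 : 0 < (S t).re := by linarith
    have h3 : Λ (σ (S t)) = Complex.log (S t) / ρ := hl (hmem _ h0)
    rw [hq]
    simp only
    rw [h3, hρlog _ h0, h2]
  · intro z hz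
    obtain ⟨s, hs, hsz, -⟩ := hW z hz
    exact ⟨s, hs, hsz⟩

end PrescribedTracts

/-! ### Assembly -/

open PrescribedTracts in
theorem proposition6p7 (V : Set ℂ) (hV : PrescribedTracts.IsUnboundedJordanDomain V)
    (Ψ : ℂ → ℂ) (hΨ : PrescribedTracts.IsConformalIso Ψ V PrescribedTracts.rightHalfPlane)
    (hΨ_inf : PrescribedTracts.FixesInfinity Ψ V)
    (ρ : ℝ) (hρ1 : 1 < ρ) (hρ2 : ρ < 2)
    (f : ℂ → ℂ) (hf : ∀ z ∈ V, f z = Complex.exp (Ψ z ^ (ρ : ℂ))) :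
    ∃ (g : ℂ → ℂ) (K : ℝ), PrescribedTracts.EremenkoLyubich g ∧ 0 < K ∧
      (IsOpen {z : ℂ | K < ‖g z‖} ∧ IsSimplyConnected {z : ℂ | K < ‖g z‖} ∧
        {z : ℂ | K < ‖g z‖} ⊆ V ∧
        -- the restriction of `g` to `{z | K < ‖g z‖}`, as a map onto `{w | K < ‖w‖}`
        PrescribedTracts.IsUniversalCovering ({w : ℂ | K < ‖w‖}.restrictPreimage g)) ∧
      ((∃ C : ℝ, ∀ z ∈ {z : ℂ | K < ‖g z‖}, ‖g z - f z‖ ≤ C) ∧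
        (∃ C : ℝ, ∀ z ∉ {z : ℂ | K < ‖g z‖}, ‖g z‖ ≤ C)) := by
  obtain ⟨hΨd, hΨb⟩ := hΨ
  have hl : LeftInvOn (Function.invFunOn Ψ V) Ψ V := hΨb.injOn.leftInvOn_invFunOn
  obtain ⟨-, hinvd⟩ := differentiableOn_of_leftInvOn hV.isOpen hΨd hΨb.injOn hl
  rw [hΨb.image_eq] at hinvd
  set Φ : ℂ → ℂ := fun s => Function.invFunOn Ψ V (Complex.exp s) with hΦ
  have hpos : ∀ z ∈ V, 0 < (Ψ z).re := fun z hz => hΨb.mapsTo hz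
  have hne : ∀ z ∈ V, Ψ z ≠ 0 := fun z hz h => by
    have := hpos z hz
    simp [h] at this
  have hexp : MapsTo Complex.exp strip rightHalfPlane := by
    intro s hs
    rw [rightHalfPlane, mem_ofPred_eq, Complex.exp_re]
    exact mul_pos (Real.exp_pos _) (Real.cos_pos_of_mem_Ioo (abs_lt.1 hs))
  have hlogexp : ∀ s ∈ strip, Complex.log (Complex.exp s) = s := by
    intro s hs
    have h1 := abs_lt.1 (mem_strip.1 hs)
    exact Complex.log_exp (by linarith [Real.pi_pos]) (by linarith [Real.pi_pos])
  have hlogmem : ∀ z ∈ V, Complex.log (Ψ z) ∈ strip := by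
    intro z hz
    rw [mem_strip, Complex.log_im]
    exact Complex.abs_arg_lt_pi_div_two_iff.2 (Or.inl (hpos z hz))
  have hΦlog : ∀ z ∈ V, Φ (Complex.log (Ψ z)) = z := by
    intro z hz
    rw [hΦ]
    simp only
    rw [Complex.exp_log (hne z hz), hl hz]
  have hΨΦ : ∀ s ∈ strip, Φ s ∈ V ∧ Ψ (Φ s) = Complex.exp s := by
    intro s hs
    obtain ⟨z, hz, hzs⟩ := hΨb.surjOn (hexp hs)
    have : Φ s = z := by rw [hΦ]; simp only; rw [← hzs, hl hz]
    rw [this]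
    exact ⟨hz, hzs⟩
  have himg : Φ '' strip = V := by
    refine Subset.antisymm ?_ fun z hz => ⟨_, hlogmem z hz, hΦlog z hz⟩
    rintro _ ⟨s, hs, rfl⟩
    exact (hΨΦ s hs).1
  have hd : DifferentiableOn ℂ Φ strip :=
    hinvd.comp Complex.differentiable_exp.differentiableOn hexp
  have hinj : InjOn Φ strip := by
    intro s hs s' hs' h
    rw [← hlogexp s hs, ← hlogexp s' hs', ← (hΨΦ s hs).2, ← (hΨΦ s' hs').2, h]
  obtain ⟨p₀, hp₀⟩ := hV.exists_notMem
  -- The Jordan property and Ψ(∞) = ∞ enter here together.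
  have hinf : ∀ θ < Real.pi / 2, ∀ M : ℝ, ∃ X, ∀ s : ℂ, X ≤ s.re → |s.im| ≤ θ → M < ‖Φ s‖ :=
    fun θ hθ M => exists_forall_lt_norm_of_strip hd hinj
      (p := p₀) (fun s hs h => hp₀ (by rw [← h]; exact (hΨΦ s hs).1))
      (exists_large_of_jordan hV hΨd.continuousOn hΨb.mapsTo hΨ_inf hΦlog) hθ M
  obtain ⟨g, C, hgd, hgC, hgC'⟩ := exists_entire_approx hd hinj hρ1 hρ2 hinf
  obtain ⟨K, p, q, htract, hsub⟩ := exists_isExpTract hd hinj hρ1 hρ2 hgd hgC hgC'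
  rw [himg] at hsub
  refine ⟨g, K, ⟨hgd, htract.not_polynomial,
    Metric.isBounded_closedBall.subset htract.singularValues_subset⟩, htract.pos,
    ⟨isOpen_lt continuous_const hgd.continuous.norm, htract.simplyConnectedSpace, hsub,
      htract.isUniversalCovering⟩, ⟨C, fun z hz => ?_⟩, ⟨K, fun z hz => not_lt.1 hz⟩⟩
  have hzV := hsub hz
  have h := hgC _ (hlogmem z hzV)
  rwa [hΦlog z hzV, expExp, mul_comm,
    ← Complex.cpow_def_of_ne_zero (hne z hzV), ← hf z hzV] at h
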